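/- Let $\mathcal S_1$ and $\mathcal S_2$ be stabilizer codes on $n_1$ and $n_2$ qubits, i.e. Abelian subgroups of the Pauli groups on $n_1$ and $n_2$ qubits that do not contain $-I$, and suppose that $\mathcal S_2$ encodes exactly one logical qubit ($|\mathcal S_2| = 2^{n_2-1}$). For a stabilizer code $\mathcal S$, the logical Pauli operators are the elements of the normalizer of $\mathcal S$ in the Pauli group; a logical Pauli operator $L$ is non-trivial if it is not a phase times an element of $\mathcal S$, and the set of its representatives is $\overline L = L\mathcal S$. Write $\mathcal L$ for the set of non-trivial logical Pauli operators, $\operatorname{supp} P$ for the set of qubits on which a Pauli operator $P$ acts non-trivially, and $$d(\overline L) = \min_{P\in\overline L} |\operatorname{supp} P|,\qquad d_\downarrow = \min_{\overline L\in\mathcal L} d(\overline L),\qquad d_\uparrow = \max_{\overline L\in\mathcal L} d(\overline L).$$ For a positive integer $c$ let $\Delta_c(\overline L)$ be $c^{-1}$ times the largest cardinality of a multiset of representatives of $\overline L$ such that at most $c$ of its elements are supported on any given qubit, and let the disjointness be $\Delta(\mathcal S) = \sup_{c\ge 1}\min_{\overline L\in\mathcal L}\Delta_c(\overline L)$. Let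 $\mathcal S_1\lhd\mathcal S_2$ be the concatenated code on $n_1n_2$ qubits, in which every qubit of $\mathcal S_1$ is encoded into $\mathcal S_2$: fix logical Pauli operators $\overline X,\overline Z$ of $\mathcal S_2$ with $\overline X^2=\overline Z^2=I$ and $\overline Z\,\overline X=-\overline X\,\overline Z$; then $\mathcal S_1\lhd\mathcal S_2$ is generated by the elements of $\mathcal S_2$ on each of the $n_1$ blocks of $n_2$ qubits and by the elements of $\mathcal S_1$ in which $X$ and $Z$ on every qubit are replaced by $\overline X$ and $\overline Z$ on the corresponding block. Suppose that, for $i\in\{1,2\}$, $\mathcal S_i$ has non-trivial logical Pauli operators, min-distance $d^{(i)}_\downarrow>1$ and max-distance $d^{(i)}_\uparrow$, and write $\Delta^{(i)}=\Delta(\mathcal S_i)$. Then $$\Delta(\mathcal S_1\lhd\mathcal S_2)\ \ge\ \Delta(\mathcal S_1)\,\Delta(\mathcal S_2).$$ Moreover, $\Delta^{(1)},\Delta^{(2)}>1$, and the level $M$ of the logical Clifford hierarchy attainable by transversal logical gates for $\mathcal S_1\lhd\mathcal S_2$ exists and satisfies $$M\ \le\ \max_{i\in\{1,2\}}\left\lfloor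 \log_{\Delta^{(i)}}\!\left(d^{(i)}_\uparrow/d^{(i)}_\downarrow\right)\right\rfloor+2 .$$ Here a transversal logical gate is a tensor product of single-qubit unitaries that preserves the code space (the joint $(+1)$-eigenspace of the stabilizers). The first level of the logical Clifford hierarchy consists of the unitaries preserving the code space that act on it as a logical Pauli operator up to a phase, and level $m+1$ consists of the unitaries $U$ preserving the code space such that $UPU^\dagger$ is in level $m$ for every logical Pauli operator $P$. The attainable level $M$ is the smallest $M\ge 1$ such that every transversal logical gate is in level $M$. -/

import Mathlib

/-- The Pauli operator `i ^ phase * ⨂ q, X ^ (x q) * Z ^ (z q)` on the qubits `Q`. -/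
@[ext]
structure PauliOp (Q : Type*) where
  phase : ZMod 4
  x : Q → ZMod 2
  z : Q → ZMod 2

namespace PauliOp

/-- The phase exponent in `Z ^ a * X ^ b = i ^ (swapPhase a b) * X ^ b * Z ^ a`:
it is `2` if `a = b = 1`, and `0` otherwise. -/
def swapPhase (a b : ZMod 2) : ZMod 4 := 2 * ((a.val * b.val : ℕ) : ZMod 4)

theorem swapPhase_add_left (a b c : ZMod 2) :
    swapPhase (a + b) c = swapPhase a c + swapPhase b c := by
  revert a b c; decide

theorem swapPhase_add_right (a b c : ZMod 2) :
    swapPhase a (b + c) = swapPhase a b + swapPhase a c := by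
  revert a b c; decide

theorem swapPhase_add_self (a b : ZMod 2) : swapPhase a b + swapPhase a b = 0 := by
  revert a b; decide

section Basic

variable {Q : Type*}

instance : One (PauliOp Q) := ⟨⟨0, 0, 0⟩⟩

/-- The scalar Pauli operator `i ^ k * I`. -/
def scalar (k : ZMod 4) : PauliOp Q := ⟨k, 0, 0⟩

theorem add_self_fun (f : Q → ZMod 2) : f + f = 0 := by
  funext q
  exact CharTwo.add_self_eq_zero (f q)

theorem scalar_zero : (scalar 0 : PauliOp Q) = 1 := rfl

@[simp] theorem one_phase : (1 : PauliOp Q).phase = 0 := rfl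
@[simp] theorem one_x : (1 : PauliOp Q).x = 0 := rfl
@[simp] theorem one_z : (1 : PauliOp Q).z = 0 := rfl
@[simp] theorem scalar_phase (k : ZMod 4) : (scalar k : PauliOp Q).phase = k := rfl
@[simp] theorem scalar_x (k : ZMod 4) : (scalar k : PauliOp Q).x = 0 := rfl
@[simp] theorem scalar_z (k : ZMod 4) : (scalar k : PauliOp Q).z = 0 := rfl

end Basic

section Group

variable {Q : Type*} [Fintype Q]

instance : Mul (PauliOp Q) :=
  ⟨fun p r => ⟨p.phase + r.phase + ∑ q, swapPhase (p.z q) (r.x q), p.x + r.x, p.z + r.z⟩⟩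

instance : Inv (PauliOp Q) :=
  ⟨fun p => ⟨-p.phase + ∑ q, swapPhase (p.z q) (p.x q), p.x, p.z⟩⟩

@[simp] theorem mul_phase (p r : PauliOp Q) :
    (p * r).phase = p.phase + r.phase + ∑ q, swapPhase (p.z q) (r.x q) := rfl
@[simp] theorem mul_x (p r : PauliOp Q) : (p * r).x = p.x + r.x := rfl
@[simp] theorem mul_z (p r : PauliOp Q) : (p * r).z = p.z + r.z := rfl
@[simp] theorem inv_phase (p : PauliOp Q) :
    (p⁻¹).phase = -p.phase + ∑ q, swapPhase (p.z q) (p.x q) := rfl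
@[simp] theorem inv_x (p : PauliOp Q) : (p⁻¹).x = p.x := rfl
@[simp] theorem inv_z (p : PauliOp Q) : (p⁻¹).z = p.z := rfl

theorem swapPhase_zero_left (a : ZMod 2) : swapPhase 0 a = 0 := by revert a; decide
theorem swapPhase_zero_right (a : ZMod 2) : swapPhase a 0 = 0 := by revert a; decide

/-- The Pauli group on the qubits `Q`. -/
instance : Group (PauliOp Q) :=
  Group.ofLeftAxioms
    (by
      intro a b c
      ext1
      · simp only [mul_phase, mul_x, mul_z, Pi.add_apply, swapPhase_add_left,
          swapPhase_add_right, Finset.sum_add_distrib]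
        ring
      · simp [add_assoc]
      · simp [add_assoc])
    (by
      intro a
      ext1 <;> simp [swapPhase_zero_left])
    (by
      intro a
      ext1
      · simp only [mul_phase, inv_phase, inv_z, one_phase]
        have h : ∑ q, swapPhase (a.z q) (a.x q) + ∑ q, swapPhase (a.z q) (a.x q) = 0 := by
          rw [← Finset.sum_add_distrib]
          exact Finset.sum_eq_zero fun q _ => swapPhase_add_self _ _
        linear_combination h
      · simp [add_self_fun]
      · simp [add_self_fun])

theorem scalar_comm (k : ZMod 4) (p : PauliOp Q) : scalar k * p = p * scalar k := by
  ext1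
  · simp [swapPhase_zero_left, swapPhase_zero_right, add_comm]
  · simp
  · simp

theorem scalar_mul_scalar (k l : ZMod 4) :
    (scalar k * scalar l : PauliOp Q) = scalar (k + l) := by
  ext1 <;> simp [swapPhase_zero_left]

/-- Any two Pauli operators commute or anticommute. -/
theorem mul_eq_or (p r : PauliOp Q) : p * r = r * p ∨ p * r = scalar 2 * (r * p) := by
  have hk : ∀ k : ℕ, 2 * (k : ZMod 4) = 0 ∨ 2 * (k : ZMod 4) = 2 := fun k => by
    generalize (k : ZMod 4) = m
    revert m; decide
  have hs : ∀ f g : Q → ZMod 2,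
      ∑ q, swapPhase (f q) (g q) = 0 ∨ ∑ q, swapPhase (f q) (g q) = 2 := by
    intro f g
    simp only [swapPhase]
    rw [← Finset.mul_sum, ← Nat.cast_sum]
    exact hk _
  have h22 : (2 : ZMod 4) + 2 = 0 := by decide
  rcases hs p.z r.x with h1 | h1 <;> rcases hs r.z p.x with h2 | h2
  · left; ext1 <;> simp [h1, h2, add_comm]
  · right; ext1
    · simp only [mul_phase, scalar_phase, scalar_z, Pi.zero_apply, swapPhase_zero_left,
        Finset.sum_const_zero, h1, h2]
      linear_combination -h22
    · simp [add_comm]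
    · simp [add_comm]
  · right; ext1
    · simp only [mul_phase, scalar_phase, scalar_z, Pi.zero_apply, swapPhase_zero_left,
        Finset.sum_const_zero, h1, h2]
      ring
    · simp [add_comm]
    · simp [add_comm]
  · left; ext1 <;> simp [h1, h2, add_comm]

/-- The set of qubits on which a Pauli operator acts non-trivially. -/
def supp (p : PauliOp Q) : Finset Q := {q | p.x q ≠ 0 ∨ p.z q ≠ 0}

end Group

end PauliOp

/-- The tensor product `⨂ q, u q` of single-qubit operators, as a matrix in the computational
basis of the qubits `Q`, which is indexed by `Q → Fin 2`. -/
def tensorOp {Q : Type*} [Fintype Q] (u : Q → Matrix (Fin 2) (Fin 2) ℂ) :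
    Matrix (Q → Fin 2) (Q → Fin 2) ℂ :=
  fun a b => ∏ q, u q (a q) (b q)

theorem tensorOp_mul {Q : Type*} [Fintype Q] [DecidableEq Q]
    (u v : Q → Matrix (Fin 2) (Fin 2) ℂ) :
    tensorOp u * tensorOp v = tensorOp fun q => u q * v q := by
  ext a b
  simp only [tensorOp, Matrix.mul_apply, ← Finset.prod_mul_distrib]
  rw [Finset.prod_univ_sum, Fintype.piFinset_univ]

theorem tensorOp_smul {Q : Type*} [Fintype Q] (c : Q → ℂ)
    (u : Q → Matrix (Fin 2) (Fin 2) ℂ) :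
    tensorOp (fun q => c q • u q) = (∏ q, c q) • tensorOp u := by
  ext a b
  simp [tensorOp, Finset.prod_mul_distrib]

theorem tensorOp_one {Q : Type*} [Fintype Q] :
    tensorOp (fun _ : Q => (1 : Matrix (Fin 2) (Fin 2) ℂ)) = 1 := by
  classical
  ext a b
  simp only [tensorOp, Matrix.one_apply]
  by_cases h : a = b
  · simp [h]
  · obtain ⟨q, hq⟩ := Function.ne_iff.mp h
    rw [if_neg h]
    exact Finset.prod_eq_zero (Finset.mem_univ q) (if_neg hq)

/-- The single-qubit operator `X ^ a * Z ^ b`. -/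
def pauliMatrix (a b : ZMod 2) : Matrix (Fin 2) (Fin 2) ℂ :=
  !![0, 1; 1, 0] ^ a.val * !![1, 0; 0, -1] ^ b.val

theorem pauliMatrix_mul (a b c d : ZMod 2) :
    pauliMatrix a b * pauliMatrix c d
      = Complex.I ^ (PauliOp.swapPhase b c).val • pauliMatrix (a + c) (b + d) := by
  have h2 : ∀ e : ZMod 2, e = 0 ∨ e = 1 := by decide
  have h11 : (1 : ZMod 2) + 1 = 0 := by decide
  have hv : (1 : ZMod 2).val = 1 := rfl
  have hs : (PauliOp.swapPhase 1 1).val = 2 := by decide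
  have hs' : (PauliOp.swapPhase 1 0).val = 0 := by decide
  have hs'' : ∀ e, (PauliOp.swapPhase 0 e).val = 0 := by decide
  rcases h2 a with rfl | rfl <;> rcases h2 b with rfl | rfl <;> rcases h2 c with rfl | rfl <;>
    rcases h2 d with rfl | rfl <;>
    simp [pauliMatrix, h11, hv, hs, hs', hs'', Matrix.one_fin_two]

namespace PauliOp

section Operator

variable {Q : Type*} [Fintype Q] [DecidableEq Q]

theorem I_pow_val_add (k l : ZMod 4) :
    Complex.I ^ (k + l).val = Complex.I ^ k.val * Complex.I ^ l.val := by
  rw [← pow_add, ZMod.val_add, ← Complex.I_pow_eq_pow_mod]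

theorem I_pow_val_sum (f : Q → ZMod 4) :
    Complex.I ^ (∑ q, f q).val = ∏ q, Complex.I ^ (f q).val := by
  classical
  induction (Finset.univ : Finset Q) using Finset.induction_on with
  | empty => simp
  | insert a s ha ih => rw [Finset.sum_insert ha, Finset.prod_insert ha, I_pow_val_add, ih]

/-- The operator on the Hilbert space of the qubits `Q` given by an element of the Pauli group. -/
noncomputable def toMatrix : PauliOp Q →* Matrix (Q → Fin 2) (Q → Fin 2) ℂ where
  toFun p := Complex.I ^ p.phase.val • tensorOp fun q => pauliMatrix (p.x q) (p.z q)
  map_one' := by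
    have : pauliMatrix 0 0 = 1 := by simp [pauliMatrix]
    simp [this, tensorOp_one]
  map_mul' p r := by
    simp only [mul_phase, mul_x, mul_z, Pi.add_apply, I_pow_val_add, I_pow_val_sum,
      smul_mul_smul_comm, tensorOp_mul, pauliMatrix_mul, tensorOp_smul, smul_smul]

end Operator

end PauliOp

/-- A stabilizer code on the qubits `Q`, given by its stabilizer group: an Abelian subgroup of the
Pauli group that does not contain `-I`. -/
structure StabilizerCode (Q : Type*) [Fintype Q] where
  group : Subgroup (PauliOp Q)
  comm : ∀ s ∈ group, ∀ t ∈ group, s * t = t * s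
  neg_one_notMem : PauliOp.scalar 2 ∉ group

namespace StabilizerCode

section Code

variable {Q : Type*} [Fintype Q]

/-- The code encodes `k` logical qubits, i.e. its stabilizer group has `|Q| - k` independent
generators. -/
def Encodes (S : StabilizerCode Q) (k : ℕ) : Prop :=
  Nat.card S.group * 2 ^ k = 2 ^ Fintype.card Q

/-- The logical Pauli operators: the normalizer of the stabilizer group in the Pauli group. -/
def logicalPaulis (S : StabilizerCode Q) : Subgroup (PauliOp Q) :=
  Subgroup.normalizer (S.group : Set (PauliOp Q))

/-- The equivalent representatives of the logical Pauli operator `L`. -/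
def representatives (S : StabilizerCode Q) (L : PauliOp Q) : Set (PauliOp Q) :=
  {P | ∃ s ∈ S.group, P = L * s}

/-- The non-trivial logical Pauli operators: those that are not stabilizers up to a phase. -/
def nontrivialLogicals (S : StabilizerCode Q) : Set (PauliOp Q) :=
  {L | L ∈ S.logicalPaulis ∧ ∀ k : ZMod 4, PauliOp.scalar k * L ∉ S.group}

/-- The distance of a logical Pauli operator: the smallest weight of a representative. -/
noncomputable def distance (S : StabilizerCode Q) (L : PauliOp Q) : ℕ :=
  sInf {w | ∃ P ∈ S.representatives L, w = P.supp.card}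

/-- The min-distance of a code (it is `0` if there is no non-trivial logical Pauli operator). -/
noncomputable def minDistance (S : StabilizerCode Q) : ℕ :=
  sInf {d | ∃ L ∈ S.nontrivialLogicals, d = S.distance L}

/-- The max-distance of a code (it is `0` if there is no non-trivial logical Pauli operator). -/
noncomputable def maxDistance (S : StabilizerCode Q) : ℕ :=
  sSup {d | ∃ L ∈ S.nontrivialLogicals, d = S.distance L}

/-- `A` is a `c`-disjoint collection of representatives of `L`: a multiset of representatives such
that at most `c` of its elements are supported on any given qubit. -/
def IsDisjointCollection (S : StabilizerCode Q) (c : ℕ) (L : PauliOp Q)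
    (A : Multiset (PauliOp Q)) : Prop :=
  (∀ P ∈ A, P ∈ S.representatives L) ∧
    ∀ q : Q, (A.filter fun P => P.x q ≠ 0 ∨ P.z q ≠ 0).card ≤ c

/-- The `c`-disjointness of a logical Pauli operator. -/
noncomputable def cDisjointness (S : StabilizerCode Q) (c : ℕ) (L : PauliOp Q) : ℝ :=
  (c : ℝ)⁻¹ * (sSup {m | ∃ A, S.IsDisjointCollection c L A ∧ m = A.card} : ℕ)

/-- The disjointness of a stabilizer code. -/
noncomputable def disjointness (S : StabilizerCode Q) : ℝ :=
  ⨆ c : ℕ+, ⨅ L : S.nontrivialLogicals, S.cDisjointness c L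

end Code

section Gates

variable {Q : Type*} [Fintype Q] [DecidableEq Q]

/-- The code space: the simultaneous `+1` eigenspace of all the stabilizer operators. -/
noncomputable def codeSpace (S : StabilizerCode Q) : Submodule ℂ ((Q → Fin 2) → ℂ) where
  carrier := {ψ | ∀ s ∈ S.group, s.toMatrix.mulVec ψ = ψ}
  add_mem' := by
    intro a b ha hb s hs
    rw [Matrix.mulVec_add, ha s hs, hb s hs]
  zero_mem' := by
    intro s _
    exact Matrix.mulVec_zero _
  smul_mem' := by
    intro c a ha s hs
    rw [Matrix.mulVec_smul, ha s hs]

/-- A logical gate: a unitary operator that preserves the code space. -/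
def IsLogicalGate (S : StabilizerCode Q) (U : Matrix (Q → Fin 2) (Q → Fin 2) ℂ) : Prop :=
  U ∈ Matrix.unitaryGroup (Q → Fin 2) ℂ ∧ ∀ ψ ∈ S.codeSpace, U.mulVec ψ ∈ S.codeSpace

/-- A transversal logical gate: a tensor product of single-qubit unitaries that preserves the code
space. -/
def IsTransversalGate (S : StabilizerCode Q) (U : Matrix (Q → Fin 2) (Q → Fin 2) ℂ) : Prop :=
  S.IsLogicalGate U ∧
    ∃ u : Q → Matrix (Fin 2) (Fin 2) ℂ,
      (∀ q, u q ∈ Matrix.unitaryGroup (Fin 2) ℂ) ∧ U = tensorOp u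

/-- The levels `1, 2, 3, …` of the logical Clifford hierarchy. A logical gate is in the first level
if it acts on the code space as a logical Pauli operator, up to a phase; it is in level `m + 1` if
it conjugates every logical Pauli operator into level `m`. There is no level `0`. -/
def logicalClifford (S : StabilizerCode Q) : ℕ → Set (Matrix (Q → Fin 2) (Q → Fin 2) ℂ)
  | 0 => ∅
  | 1 => {U | S.IsLogicalGate U ∧ ∃ P ∈ S.logicalPaulis, ∃ c : ℂ,
      ∀ ψ ∈ S.codeSpace, U.mulVec ψ = c • P.toMatrix.mulVec ψ}
  | m + 2 => {U | S.IsLogicalGate U ∧ ∀ P ∈ S.logicalPaulis,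
      U * P.toMatrix * U.conjTranspose ∈ S.logicalClifford (m + 1)}

/-- `M` is the level of the logical Clifford hierarchy attainable by transversal logical gates: the
smallest `M ≥ 1` such that all transversal logical gates are in level `M`. -/
def IsTransversalLevel (S : StabilizerCode Q) (M : ℕ) : Prop :=
  IsLeast {m | 1 ≤ m ∧ ∀ U, S.IsTransversalGate U → U ∈ S.logicalClifford m} M

end Gates

end StabilizerCode

/-- A choice of logical `X` and `Z` operators for a logical qubit of a stabilizer code. -/
structure LogicalQubit {Q : Type*} [Fintype Q] (S : StabilizerCode Q) where
  X : PauliOp Q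
  Z : PauliOp Q
  X_mem : X ∈ S.logicalPaulis
  Z_mem : Z ∈ S.logicalPaulis
  X_sq : X * X = 1
  Z_sq : Z * Z = 1
  anticomm : Z * X = PauliOp.scalar 2 * (X * Z)

namespace PauliOp

variable {Q₁ Q₂ : Type*} [Fintype Q₁] [Fintype Q₂]

/-- The tensor product `⨂ q, g q` of Pauli operators on blocks of qubits. -/
def blockTensor : (Q₁ → PauliOp Q₂) →* PauliOp (Q₁ × Q₂) where
  toFun g := ⟨∑ q, (g q).phase, fun q => (g q.1).x q.2, fun q => (g q.1).z q.2⟩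
  map_one' := by
    ext1 <;> simp <;> rfl
  map_mul' g h := by
    ext1
    · simp [Finset.sum_add_distrib, Fintype.sum_prod_type]
    · rfl
    · rfl

theorem blockTensor_scalar_mul (k : Q₁ → ZMod 4) (g : Q₁ → PauliOp Q₂) :
    blockTensor (fun q => scalar (k q) * g q) = scalar (∑ q, k q) * blockTensor g := by
  ext1
  · simp [blockTensor, swapPhase_zero_left, Finset.sum_add_distrib]
  · ext; simp [blockTensor]
  · ext; simp [blockTensor]

end PauliOp

namespace LogicalQubit

section Single

variable {Q : Type*} [Fintype Q] {S : StabilizerCode Q}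

/-- The logical operator `X̄ ^ a * Z̄ ^ b`. -/
def pauli (B : LogicalQubit S) (a b : ZMod 2) : PauliOp Q := B.X ^ a.val * B.Z ^ b.val

theorem pauli_mul (B : LogicalQubit S) (a b c d : ZMod 2) :
    B.pauli a b * B.pauli c d
      = PauliOp.scalar (PauliOp.swapPhase b c) * B.pauli (a + c) (b + d) := by
  have h2 : ∀ e : ZMod 2, e = 0 ∨ e = 1 := by decide
  have hadd : ∀ (g : PauliOp Q), g * g = 1 → ∀ e f : ZMod 2,
      g ^ e.val * g ^ f.val = g ^ (e + f).val := by
    intro g hg e f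
    have h11 : (1 : ZMod 2) + 1 = 0 := by decide
    have hv : (1 : ZMod 2).val = 1 := rfl
    rcases h2 e with rfl | rfl <;> rcases h2 f with rfl | rfl <;> simp [h11, hv, hg]
  have hsw : B.Z ^ b.val * B.X ^ c.val
      = PauliOp.scalar (PauliOp.swapPhase b c) * (B.X ^ c.val * B.Z ^ b.val) := by
    have hv : (1 : ZMod 2).val = 1 := rfl
    have hs : PauliOp.swapPhase 1 1 = 2 := by decide
    rcases h2 b with rfl | rfl <;> rcases h2 c with rfl | rfl <;>
      simp [hv, hs, PauliOp.swapPhase_zero_left, PauliOp.swapPhase_zero_right,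
        PauliOp.scalar_zero, B.anticomm]
  calc B.pauli a b * B.pauli c d
      = B.X ^ a.val * (B.Z ^ b.val * B.X ^ c.val) * B.Z ^ d.val := by
        simp only [pauli, mul_assoc]
    _ = B.X ^ a.val * PauliOp.scalar (PauliOp.swapPhase b c) * B.X ^ c.val
          * (B.Z ^ b.val * B.Z ^ d.val) := by
        rw [hsw]; simp only [mul_assoc]
    _ = PauliOp.scalar (PauliOp.swapPhase b c) * ((B.X ^ a.val * B.X ^ c.val)
          * (B.Z ^ b.val * B.Z ^ d.val)) := by
        rw [← PauliOp.scalar_comm]; simp only [mul_assoc]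
    _ = _ := by rw [hadd _ B.X_sq, hadd _ B.Z_sq, pauli]

theorem pauli_mem (B : LogicalQubit S) (a b : ZMod 2) : B.pauli a b ∈ S.logicalPaulis :=
  mul_mem (pow_mem B.X_mem _) (pow_mem B.Z_mem _)

end Single

section Encode

variable {Q₁ Q₂ : Type*} [Fintype Q₁] [Fintype Q₂] {S₂ : StabilizerCode Q₂}

/-- Encoding each of the qubits `Q₁` into its own block `Q₂` of the code `S₂`: the operators `X`
and `Z` on a qubit are replaced by the logical `X` and `Z` operators of the corresponding block. -/
def encode (B : LogicalQubit S₂) : PauliOp Q₁ →* PauliOp (Q₁ × Q₂) where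
  toFun p := PauliOp.scalar p.phase * PauliOp.blockTensor fun q => B.pauli (p.x q) (p.z q)
  map_one' := by
    have h : (fun _ : Q₁ => B.pauli 0 0) = 1 := by funext q; simp [pauli]
    simp [h, PauliOp.scalar_zero]
  map_mul' p r := by
    have h : PauliOp.blockTensor (fun q : Q₁ => B.pauli (p.x q) (p.z q))
          * PauliOp.blockTensor (fun q : Q₁ => B.pauli (r.x q) (r.z q))
        = PauliOp.scalar (∑ q, PauliOp.swapPhase (p.z q) (r.x q))
          * PauliOp.blockTensor (fun q : Q₁ => B.pauli ((p * r).x q) ((p * r).z q)) := by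
      rw [← map_mul, ← PauliOp.blockTensor_scalar_mul]
      congr 1
      funext q
      exact B.pauli_mul _ _ _ _
    rw [mul_assoc, ← mul_assoc (PauliOp.blockTensor _), ← PauliOp.scalar_comm, mul_assoc,
      h, PauliOp.mul_phase, ← PauliOp.scalar_mul_scalar, ← PauliOp.scalar_mul_scalar]
    simp only [mul_assoc]

end Encode

end LogicalQubit

namespace StabilizerCode

section Concatenation

variable {Q₁ Q₂ : Type*} [Fintype Q₁] [Fintype Q₂]

theorem commute_of_mem {Q : Type*} [Fintype Q] (S : StabilizerCode Q) {L s : PauliOp Q}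
    (hL : L ∈ S.logicalPaulis) (hs : s ∈ S.group) : L * s = s * L := by
  rcases PauliOp.mul_eq_or L s with h | h
  · exact h
  · exfalso
    have h1 : L * s * L⁻¹ ∈ S.group := (Subgroup.mem_normalizer_iff.mp hL s).mp hs
    rw [h, mul_assoc, mul_inv_cancel_right] at h1
    exact S.neg_one_notMem ((Subgroup.mul_mem_cancel_right _ hs).mp h1)

theorem eq_zero_of_pauli_mul_mem {S : StabilizerCode Q₂} (B : LogicalQubit S) {a b : ZMod 2}
    {k : ZMod 4} {t : PauliOp Q₂} (ht : t ∈ S.group)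
    (h : B.pauli a b * t = PauliOp.scalar k) : a = 0 ∧ b = 0 := by
  have key : ∀ L ∈ S.logicalPaulis, B.pauli a b * L = L * B.pauli a b := by
    intro L hL
    have ht' := S.commute_of_mem hL (inv_mem ht)
    rw [eq_mul_inv_of_mul_eq h, mul_assoc, ← ht', ← mul_assoc, ← mul_assoc, PauliOp.scalar_comm]
  have hph : ∀ {k l : ZMod 4} {p : PauliOp Q₂},
      PauliOp.scalar k * p = PauliOp.scalar l * p → k = l := by
    intro k l p hp
    exact congrArg PauliOp.phase (mul_right_cancel hp)
  constructor
  · have h1 := key _ (B.pauli_mem 0 1)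
    rw [B.pauli_mul, B.pauli_mul, add_comm a, add_comm b] at h1
    have h2 := hph h1
    clear h h1 key
    revert a b; decide
  · have h1 := key _ (B.pauli_mem 1 0)
    rw [B.pauli_mul, B.pauli_mul, add_comm a, add_comm b] at h1
    have h2 := hph h1
    clear h h1 key
    revert a b; decide

theorem scalar_mem {Q : Type*} [Fintype Q] (S : StabilizerCode Q) {k : ZMod 4}
    (hk : PauliOp.scalar k ∈ S.group) : k = 0 := by
  have h2 : (2 : ZMod 4) ≠ k := by
    rintro rfl
    exact S.neg_one_notMem hk
  have h3 : k + k ≠ 2 := by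
    intro h
    have := mul_mem hk hk
    rw [PauliOp.scalar_mul_scalar, h] at this
    exact S.neg_one_notMem this
  revert h2 h3; clear hk; revert k; decide

/-- The stabilizer group of the concatenated code: it is generated by the stabilizers of `S₂` on
each of the blocks and by the encoded stabilizers of `S₁`. -/
def concatGroup (S₁ : StabilizerCode Q₁) (S₂ : StabilizerCode Q₂) (B : LogicalQubit S₂) :
    Subgroup (PauliOp (Q₁ × Q₂)) :=
  S₁.group.map B.encode ⊔
    (Subgroup.pi Set.univ fun _ : Q₁ => S₂.group).map PauliOp.blockTensor

theorem encode_comm (S₂ : StabilizerCode Q₂) (B : LogicalQubit S₂)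
    (p : PauliOp Q₁) (t : Q₁ → PauliOp Q₂) (ht : ∀ q, t q ∈ S₂.group) :
    B.encode p * PauliOp.blockTensor t = PauliOp.blockTensor t * B.encode p := by
  have h : PauliOp.blockTensor (fun q : Q₁ => B.pauli (p.x q) (p.z q)) * PauliOp.blockTensor t
      = PauliOp.blockTensor t * PauliOp.blockTensor fun q : Q₁ => B.pauli (p.x q) (p.z q) := by
    rw [← map_mul, ← map_mul]
    congr 1
    funext q
    exact S₂.commute_of_mem (B.pauli_mem _ _) (ht q)
  change PauliOp.scalar p.phase * PauliOp.blockTensor (fun q => B.pauli (p.x q) (p.z q)) * _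
    = _ * (PauliOp.scalar p.phase * PauliOp.blockTensor fun q => B.pauli (p.x q) (p.z q))
  rw [mul_assoc, h, ← mul_assoc, ← mul_assoc, PauliOp.scalar_comm]

theorem mem_concatGroup {S₁ : StabilizerCode Q₁} {S₂ : StabilizerCode Q₂} {B : LogicalQubit S₂}
    {g : PauliOp (Q₁ × Q₂)} :
    g ∈ concatGroup S₁ S₂ B ↔ ∃ s ∈ S₁.group, ∃ t : Q₁ → PauliOp Q₂, (∀ q, t q ∈ S₂.group) ∧
      g = B.encode s * PauliOp.blockTensor t := by
  have hle : S₁.group.map B.encode ≤ Subgroup.normalizer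
      (((Subgroup.pi Set.univ fun _ : Q₁ => S₂.group).map PauliOp.blockTensor :
        Subgroup (PauliOp (Q₁ × Q₂))) : Set (PauliOp (Q₁ × Q₂))) := by
    rw [Subgroup.le_normalizer_iff]
    rintro _ ⟨s, -, rfl⟩ _ ⟨t, ht, rfl⟩
    rw [encode_comm S₂ B s t fun q => ht q trivial, mul_inv_cancel_right]
    exact ⟨t, ht, rfl⟩
  rw [← SetLike.mem_coe, concatGroup, Subgroup.coe_mul_of_left_le_normalizer_right _ _ hle,
    Set.mem_mul]
  constructor
  · rintro ⟨_, ⟨s, hs, rfl⟩, _, ⟨t, ht, rfl⟩, rfl⟩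
    exact ⟨s, hs, t, fun q => ht q trivial, rfl⟩
  · rintro ⟨s, hs, t, ht, rfl⟩
    exact ⟨_, ⟨s, hs, rfl⟩, _, ⟨t, fun q _ => ht q, rfl⟩, rfl⟩

/-- The concatenated code `S₁ ◁ S₂`, on `|Q₁| * |Q₂|` qubits, where every qubit of the code `S₁` is
encoded into the logical qubit `B` of the code `S₂`. -/
def concat (S₁ : StabilizerCode Q₁) (S₂ : StabilizerCode Q₂) (B : LogicalQubit S₂) :
    StabilizerCode (Q₁ × Q₂) where
  group := concatGroup S₁ S₂ B
  comm := by
    intro g hg g' hg'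
    obtain ⟨s, hs, t, ht, rfl⟩ := mem_concatGroup.mp hg
    obtain ⟨s', hs', t', ht', rfl⟩ := mem_concatGroup.mp hg'
    have h1 : B.encode s * B.encode s' = B.encode s' * B.encode s := by
      rw [← map_mul, ← map_mul, S₁.comm s hs s' hs']
    have h2 : PauliOp.blockTensor t * PauliOp.blockTensor t'
        = PauliOp.blockTensor t' * PauliOp.blockTensor t := by
      rw [← map_mul, ← map_mul]
      congr 1
      funext q
      exact S₂.comm _ (ht q) _ (ht' q)
    rw [mul_assoc, ← mul_assoc (PauliOp.blockTensor t), ← encode_comm S₂ B s' t ht,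
      mul_assoc, h2, ← mul_assoc, h1, mul_assoc, mul_assoc,
      ← mul_assoc (B.encode s) (PauliOp.blockTensor t'), encode_comm S₂ B s t' ht', mul_assoc]
  neg_one_notMem := by
    intro hg
    obtain ⟨s, hs, t, ht, h⟩ := mem_concatGroup.mp hg
    change _ = PauliOp.scalar s.phase
      * PauliOp.blockTensor (fun q => B.pauli (s.x q) (s.z q)) * _ at h
    rw [mul_assoc, ← map_mul] at h
    have hblock : ∀ q, B.pauli (s.x q) (s.z q) * t q
        = PauliOp.scalar (B.pauli (s.x q) (s.z q) * t q).phase := by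
      intro q
      ext r
      · rfl
      · have := congrFun (congrArg PauliOp.x h) (q, r)
        simpa [PauliOp.blockTensor] using this.symm
      · have := congrFun (congrArg PauliOp.z h) (q, r)
        simpa [PauliOp.blockTensor] using this.symm
    have hxz := fun q => eq_zero_of_pauli_mul_mem B (ht q) (hblock q)
    have hs0 : s = PauliOp.scalar s.phase := by
      ext q
      · rfl
      · exact (hxz q).1
      · exact (hxz q).2
    have hs1 : s = 1 := by
      rw [hs0] at hs
      rw [hs0, S₁.scalar_mem hs, PauliOp.scalar_zero]
    subst hs1
    have ht1 : t = 1 := by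
      funext q
      have hq := hblock q
      have hp : B.pauli ((1 : PauliOp Q₁).x q) ((1 : PauliOp Q₁).z q) = 1 := by
        simp [LogicalQubit.pauli]
      rw [hp, one_mul] at hq
      have hm := ht q
      rw [hq] at hm
      rw [hq, S₂.scalar_mem hm, PauliOp.scalar_zero, Pi.one_apply]
    subst ht1
    have hp : ((fun q => B.pauli ((1 : PauliOp Q₁).x q) ((1 : PauliOp Q₁).z q)) * 1
        : Q₁ → PauliOp Q₂) = 1 := by
      funext q
      simp [LogicalQubit.pauli]
    rw [hp, map_one] at h
    have := congrArg PauliOp.phase h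
    simp at this
    revert this
    decide

end Concatenation

end StabilizerCode

/-!
The disjointness of a code controls how far the support of a Pauli operator can be moved away from a
given region: by double counting, a non-trivial logical operator has a representative that meets a
region `R` in at most `|R| / Δ` qubits (`exists_mem_representatives_card_supp_inter_le`). Conjugating
a logical operator `P` by a transversal gate `U` gives `K P`, where the commutator
`K = U P U† P†` is a transversal gate on the support of `P`. Hence, with suitable representatives,
the first commutator lives on at most `d↑` qubits and each further one on a region smaller by the
factor `Δ`. A logical gate on fewer than `d↓` qubits acts as a scalar
(`exists_mulVec_eq_smul_of_card_lt`), and a transversal gate that commutes with all the logical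
operators up to scalars acts as a logical operator (`mem_logicalClifford_one_of_commute`). Both
facts come from one argument: in a Pauli expansion of the gate, the terms with the wrong
commutation relations can be eliminated (`exists_expansion_commSign_eq`). Altogether, the gate is in
level `m + 2` whenever `d↑ < d↓ Δ ^ (m + 1)` (`IsTransversalGate.mem_logicalClifford`).

This is applied to the concatenated code. As the inner code has a single logical qubit, a dimension
count with the symplectic form shows that each block of a logical operator is a product of a phase,
of `X̄ ^ a Z̄ ^ b` and of a stabilizer (`exists_eq_scalar_mul_pauli_mul`), so the logical operators of
the concatenated code are the encoded logical operators of the outer code, up to stabilizers. It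
follows that `d↓` is at least the product of the two min-distances, `d↑` is at most the product of
the two max-distances and, by encoding disjoint families with disjoint families, `Δ` is at least
the product of the disjointnesses. The inequalities `d↑ < d↓ Δ ^ (m + 1)` for the two codes
therefore multiply to the same inequality for the concatenated code. Finally `Δ > 1` if `d↓ > 1`,
because then a logical operator has, for each of the `n` qubits, a representative that avoids it,
and these `n` representatives have multiplicity at most `n - 1` at any qubit.
-/

/-! ### Pauli operators as binary vectors -/

namespace PauliOp

section BinaryVector

variable {Q : Type*}

theorem ext_xz {p r : PauliOp Q} (hx : p.x = r.x) (hz : p.z = r.z)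
    (hphase : p.phase = r.phase) : p = r := PauliOp.ext hphase hx hz

/-- The binary vector `(x, z)` of a Pauli operator; it determines the operator up to a phase. -/
def vec (p : PauliOp Q) : (Q → ZMod 2) × (Q → ZMod 2) := (p.x, p.z)

theorem exists_vec_eq (v : (Q → ZMod 2) × (Q → ZMod 2)) : ∃ p : PauliOp Q, p.vec = v :=
  ⟨⟨0, v.1, v.2⟩, rfl⟩

variable [Fintype Q]

theorem scalar_mul_phase (k : ZMod 4) (p : PauliOp Q) : (scalar k * p).phase = k + p.phase := by
  simp [swapPhase_zero_left]

@[simp] theorem scalar_mul_x (k : ZMod 4) (p : PauliOp Q) : (scalar k * p).x = p.x := by simp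

@[simp] theorem scalar_mul_z (k : ZMod 4) (p : PauliOp Q) : (scalar k * p).z = p.z := by simp

theorem eq_scalar_mul_of_x_eq_of_z_eq {p r : PauliOp Q} (hx : p.x = r.x) (hz : p.z = r.z) :
    p = scalar (p.phase - r.phase) * r :=
  ext_xz (by simpa using hx) (by simpa using hz) (by rw [scalar_mul_phase]; ring)

theorem scalar_mul_scalar_mul (k l : ZMod 4) (p : PauliOp Q) :
    scalar k * (scalar l * p) = scalar (k + l) * p := by
  rw [← mul_assoc, scalar_mul_scalar]

theorem scalar_neg_mul_cancel (k : ZMod 4) (p : PauliOp Q) : scalar (-k) * (scalar k * p) = p := by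
  rw [scalar_mul_scalar_mul, neg_add_cancel, scalar_zero, one_mul]

theorem scalar_mul_comm_iff (k : ZMod 4) (p r : PauliOp Q) :
    scalar k * p * r = r * (scalar k * p) ↔ p * r = r * p := by
  rw [← mul_assoc r, ← scalar_comm k r, mul_assoc, mul_assoc, mul_right_inj]

theorem scalar_two_mul_ne (p : PauliOp Q) : scalar 2 * p ≠ p := by
  intro h
  have h1 := congrArg phase h
  rw [scalar_mul_phase, add_eq_right] at h1
  exact absurd h1 (by decide)

theorem vec_mul (p r : PauliOp Q) : (p * r).vec = p.vec + r.vec := rfl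

/-- The symplectic form on binary vectors, which detects the commutation of Pauli operators. -/
def symplecticForm (Q : Type*) [Fintype Q] :
    LinearMap.BilinForm (ZMod 2) ((Q → ZMod 2) × (Q → ZMod 2)) :=
  LinearMap.mk₂ (ZMod 2) (fun v w => ∑ q, (v.2 q * w.1 q + w.2 q * v.1 q))
    (by intro u v w; rw [← Finset.sum_add_distrib]
        exact Finset.sum_congr rfl fun q _ => by
          simp only [Prod.fst_add, Prod.snd_add, Pi.add_apply]; ring)
    (by intro c v w; rw [smul_eq_mul, Finset.mul_sum]
        exact Finset.sum_congr rfl fun q _ => by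
          simp only [Prod.smul_fst, Prod.smul_snd, Pi.smul_apply, smul_eq_mul]; ring)
    (by intro u v w; rw [← Finset.sum_add_distrib]
        exact Finset.sum_congr rfl fun q _ => by
          simp only [Prod.fst_add, Prod.snd_add, Pi.add_apply]; ring)
    (by intro c v w; rw [smul_eq_mul, Finset.mul_sum]
        exact Finset.sum_congr rfl fun q _ => by
          simp only [Prod.smul_fst, Prod.smul_snd, Pi.smul_apply, smul_eq_mul]; ring)

theorem symplecticForm_apply (v w : (Q → ZMod 2) × (Q → ZMod 2)) :
    symplecticForm Q v w = ∑ q, (v.2 q * w.1 q + w.2 q * v.1 q) := rfl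

theorem symplecticForm_comm (v w : (Q → ZMod 2) × (Q → ZMod 2)) :
    symplecticForm Q v w = symplecticForm Q w v := by
  simp only [symplecticForm_apply]
  exact Finset.sum_congr rfl fun q _ => add_comm _ _

theorem symplecticForm_isRefl : (symplecticForm Q).IsRefl := fun v w h => by
  rwa [symplecticForm_comm]

theorem symplecticForm_nondegenerate : (symplecticForm Q).Nondegenerate := by
  classical
  have h : ∀ v, (∀ w, symplecticForm Q v w = 0) → v = 0 := by
    intro v hv
    ext q
    · simpa [symplecticForm_apply, Pi.single_apply] using hv (0, Pi.single q 1)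
    · simpa [symplecticForm_apply, Pi.single_apply] using hv (Pi.single q 1, 0)
  exact ⟨h, fun v hv => h v fun w => by rw [symplecticForm_comm]; exact hv w⟩

theorem mul_comm_iff_symplecticForm (p r : PauliOp Q) :
    p * r = r * p ↔ symplecticForm Q p.vec r.vec = 0 := by
  -- `a ↦ 2 a` embeds `ZMod 2` into `ZMod 4`, and `swapPhase a b` is the image of `a * b`.
  let dbl : ZMod 2 →+ ZMod 4 := AddMonoidHom.mk' (swapPhase 1) (swapPhase_add_right 1)
  have hdbl : ∀ a b, swapPhase a b = dbl (a * b) := by decide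
  have hinj : Function.Injective dbl := by
    intro a b; revert a b; decide
  have hp : p * r = r * p ↔ (p * r).phase = (r * p).phase := by
    refine ⟨congrArg _, fun h => ext_xz ?_ ?_ h⟩
    · simp [add_comm]
    · simp [add_comm]
  rw [hp, mul_phase, mul_phase, add_comm r.phase, add_right_inj]
  simp only [hdbl, ← map_sum]
  rw [hinj.eq_iff, symplecticForm_apply, Finset.sum_add_distrib]
  exact (CharTwo.add_eq_zero).symm

theorem mem_supp {p : PauliOp Q} {q : Q} : q ∈ p.supp ↔ p.x q ≠ 0 ∨ p.z q ≠ 0 := by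
  simp [supp]

theorem supp_scalar_mul (k : ZMod 4) (p : PauliOp Q) : (scalar k * p).supp = p.supp := by
  ext q
  rw [mem_supp, mem_supp, scalar_mul_x, scalar_mul_z]

theorem supp_one : (1 : PauliOp Q).supp = ∅ := by
  ext q; simp [mem_supp]

end BinaryVector

end PauliOp

/-! ### Logical operators of a stabilizer code -/

namespace StabilizerCode

open PauliOp

section Logical

variable {Q : Type*} [Fintype Q] (S : StabilizerCode Q)

theorem mem_logicalPaulis_iff {L : PauliOp Q} :
    L ∈ S.logicalPaulis ↔ ∀ s ∈ S.group, L * s = s * L := by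
  refine ⟨fun hL s hs => S.commute_of_mem hL hs, fun h => ?_⟩
  refine (Subgroup.mem_normalizer_iff).mpr fun s => ⟨fun hs => ?_, fun hs => ?_⟩
  · rwa [h s hs, mul_inv_cancel_right]
  · have h1 := h _ hs
    rw [inv_mul_cancel_right] at h1
    rwa [mul_left_cancel h1] at hs

theorem group_le_logicalPaulis : S.group ≤ S.logicalPaulis := fun s hs =>
  S.mem_logicalPaulis_iff.mpr fun t ht => S.comm s hs t ht

theorem exists_scalar_mul_mem {L : PauliOp Q} (hL : L ∈ S.logicalPaulis)
    (h : L ∉ S.nontrivialLogicals) : ∃ k : ZMod 4, scalar k * L ∈ S.group := by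
  by_contra hc
  exact h ⟨hL, fun k hk => hc ⟨k, hk⟩⟩

theorem mul_mem_nontrivialLogicals {L s : PauliOp Q} (hL : L ∈ S.nontrivialLogicals)
    (hs : s ∈ S.group) : L * s ∈ S.nontrivialLogicals :=
  ⟨mul_mem hL.1 (S.group_le_logicalPaulis hs), fun k hk => hL.2 k (by
    rwa [← mul_assoc, Subgroup.mul_mem_cancel_right _ hs] at hk)⟩

theorem mem_nontrivialLogicals_of_mem_representatives {L P : PauliOp Q}
    (hL : L ∈ S.nontrivialLogicals) (hP : P ∈ S.representatives L) :
    P ∈ S.nontrivialLogicals := by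
  obtain ⟨s, hs, rfl⟩ := hP
  exact S.mul_mem_nontrivialLogicals hL hs

theorem mem_logicalPaulis_of_mem_representatives {L P : PauliOp Q} (hL : L ∈ S.logicalPaulis)
    (hP : P ∈ S.representatives L) : P ∈ S.logicalPaulis := by
  obtain ⟨s, hs, rfl⟩ := hP
  exact mul_mem hL (S.group_le_logicalPaulis hs)

theorem self_mem_representatives (L : PauliOp Q) : L ∈ S.representatives L :=
  ⟨1, one_mem _, (mul_one L).symm⟩

/-- The space of binary vectors of the stabilizers. -/
def binarySpace : Submodule (ZMod 2) ((Q → ZMod 2) × (Q → ZMod 2)) :=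
  AddSubgroup.toZModSubmodule 2
    { carrier := vec '' S.group
      zero_mem' := ⟨1, one_mem _, rfl⟩
      add_mem' := by
        rintro _ _ ⟨s, hs, rfl⟩ ⟨t, ht, rfl⟩
        exact ⟨s * t, mul_mem hs ht, rfl⟩
      neg_mem' := by
        rintro _ ⟨s, hs, rfl⟩
        refine ⟨s, hs, ?_⟩
        ext q <;> simp [vec] }

theorem mem_binarySpace {v : (Q → ZMod 2) × (Q → ZMod 2)} :
    v ∈ S.binarySpace ↔ ∃ s ∈ S.group, s.vec = v := Iff.rfl

theorem vec_mem_binarySpace_iff {P : PauliOp Q} :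
    P.vec ∈ S.binarySpace ↔ ∃ k : ZMod 4, scalar k * P ∈ S.group := by
  rw [mem_binarySpace]
  constructor
  · rintro ⟨s, hs, h⟩
    refine ⟨s.phase - P.phase, ?_⟩
    rwa [← eq_scalar_mul_of_x_eq_of_z_eq (congrArg Prod.fst h) (congrArg Prod.snd h)]
  · rintro ⟨k, hk⟩
    exact ⟨_, hk, Prod.ext (scalar_mul_x k P) (scalar_mul_z k P)⟩

theorem mem_logicalPaulis_iff_vec {P : PauliOp Q} :
    P ∈ S.logicalPaulis ↔ P.vec ∈ (symplecticForm Q).orthogonal S.binarySpace := by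
  rw [mem_logicalPaulis_iff, LinearMap.BilinForm.mem_orthogonal_iff]
  constructor
  · rintro h _ ⟨s, hs, rfl⟩
    exact (mul_comm_iff_symplecticForm s P).mp (h s hs).symm
  · intro h s hs
    exact ((mul_comm_iff_symplecticForm s P).mpr (h _ ⟨s, hs, rfl⟩)).symm

/-- An operator that commutes with all the logical operators is a stabilizer up to a phase: the
binary space of the stabilizers is its own symplectic double complement. -/
theorem exists_scalar_mul_mem_of_commute {P : PauliOp Q}
    (h : ∀ L ∈ S.logicalPaulis, P * L = L * P) : ∃ k : ZMod 4, scalar k * P ∈ S.group := by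
  rw [← vec_mem_binarySpace_iff, ← LinearMap.BilinForm.orthogonal_orthogonal
    symplecticForm_nondegenerate symplecticForm_isRefl S.binarySpace,
    LinearMap.BilinForm.mem_orthogonal_iff]
  intro v hv
  obtain ⟨L, rfl⟩ := exists_vec_eq v
  exact (mul_comm_iff_symplecticForm L P).mp
    (h L (S.mem_logicalPaulis_iff_vec.mpr hv)).symm

theorem vec_injOn_group : Set.InjOn vec (S.group : Set (PauliOp Q)) := by
  intro s hs t ht h
  have h1 := eq_scalar_mul_of_x_eq_of_z_eq (congrArg Prod.fst h) (congrArg Prod.snd h)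
  have h2 := hs
  rw [h1] at h2
  have h3 := S.scalar_mem ((Subgroup.mul_mem_cancel_right _ ht).mp h2)
  rw [h1, h3, scalar_zero, one_mul]

theorem two_pow_finrank_binarySpace :
    2 ^ Module.finrank (ZMod 2) S.binarySpace = Nat.card S.group := by
  have h1 : Nat.card S.binarySpace = 2 ^ Module.finrank (ZMod 2) S.binarySpace := by
    rw [Module.natCard_eq_pow_finrank (K := ZMod 2), Nat.card_zmod]
  rw [← h1]
  exact Nat.card_congr (Equiv.Set.imageOfInjOn _ _ S.vec_injOn_group).symm

theorem pauli_mem_nontrivialLogicals {S : StabilizerCode Q} (B : LogicalQubit S) {a b : ZMod 2}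
    (hab : a ≠ 0 ∨ b ≠ 0) : B.pauli a b ∈ S.nontrivialLogicals := by
  refine ⟨B.pauli_mem a b, fun k hk => ?_⟩
  obtain ⟨ha, hb⟩ := eq_zero_of_pauli_mul_mem B (k := -k) (inv_mem hk) (by
    rw [mul_inv_rev, mul_inv_cancel_left, inv_eq_iff_mul_eq_one, scalar_mul_scalar,
      add_neg_cancel, scalar_zero])
  exact hab.elim (fun h => h ha) (fun h => h hb)

/-- In a code with one logical qubit, an operator that commutes with the stabilizers and with
`X̄` and `Z̄` is a stabilizer up to a phase. Indeed the stabilizers and `X̄` span a Lagrangian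
subspace, and the elements in the coset of `X̄` do not commute with `Z̄`. -/
theorem exists_scalar_mul_mem_of_commute_X_Z {S : StabilizerCode Q} (hk : S.Encodes 1)
    (B : LogicalQubit S) {L : PauliOp Q} (hL : L ∈ S.logicalPaulis) (hX : L * B.X = B.X * L)
    (hZ : L * B.Z = B.Z * L) : ∃ k : ZMod 4, scalar k * L ∈ S.group := by
  set T := S.binarySpace ⊔ Submodule.span (ZMod 2) {B.X.vec} with hT
  have hXn : B.X ∈ S.nontrivialLogicals := by
    have := pauli_mem_nontrivialLogicals B (a := 1) (b := 0) (by simp)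
    simpa [LogicalQubit.pauli, ZMod.val_one] using this
  have hlt : S.binarySpace < T := by
    refine lt_of_le_of_ne le_sup_left fun h => ?_
    have h1 : B.X.vec ∈ S.binarySpace := by
      rw [h]
      exact Submodule.mem_sup_right (Submodule.mem_span_singleton_self _)
    obtain ⟨k, hk⟩ := S.vec_mem_binarySpace_iff.mp h1
    exact hXn.2 k hk
  have hmem : ∀ P : PauliOp Q, P ∈ S.logicalPaulis → P * B.X = B.X * P →
      P.vec ∈ (symplecticForm Q).orthogonal T := by
    intro P hP hPX v hv
    obtain ⟨u, hu, w, hw, rfl⟩ := Submodule.mem_sup.mp hv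
    obtain ⟨c, rfl⟩ := Submodule.mem_span_singleton.mp hw
    rw [map_add, LinearMap.add_apply, map_smul,
      LinearMap.smul_apply, (S.mem_logicalPaulis_iff_vec.mp hP) u hu,
      (mul_comm_iff_symplecticForm B.X P).mp hPX.symm, smul_zero, add_zero]
  have hle : T ≤ (symplecticForm Q).orthogonal T := by
    refine sup_le ?_ ?_
    · rintro _ ⟨s, hs, rfl⟩
      exact hmem s (S.group_le_logicalPaulis hs) (S.commute_of_mem B.X_mem hs).symm
    · rw [Submodule.span_singleton_le_iff_mem]
      exact hmem _ B.X_mem rfl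
  have hfr : Module.finrank (ZMod 2) ((Q → ZMod 2) × (Q → ZMod 2))
      = Fintype.card Q + Fintype.card Q := by
    rw [Module.finrank_prod, Module.finrank_fintype_fun_eq_card]
  have heq : T = (symplecticForm Q).orthogonal T := by
    refine Submodule.eq_of_le_of_finrank_le hle ?_
    rw [LinearMap.BilinForm.finrank_orthogonal symplecticForm_nondegenerate, hfr]
    have h1 := Submodule.finrank_lt_finrank_of_lt hlt
    have h2 : Module.finrank (ZMod 2) S.binarySpace + 1 = Fintype.card Q := by
      have : Nat.card S.group * 2 ^ 1 = 2 ^ Fintype.card Q := hk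
      rw [← two_pow_finrank_binarySpace, ← pow_add] at this
      exact Nat.pow_right_injective le_rfl this
    omega
  have hLT := hmem L hL hX
  rw [← heq] at hLT
  obtain ⟨u, hu, w, hw, huw⟩ := Submodule.mem_sup.mp hLT
  obtain ⟨c, rfl⟩ := Submodule.mem_span_singleton.mp hw
  have hc : c = 0 := by
    have h1 := (mul_comm_iff_symplecticForm L B.Z).mp hZ
    have h2 : symplecticForm Q B.X.vec B.Z.vec ≠ 0 := by
      rw [Ne, ← mul_comm_iff_symplecticForm, B.anticomm]
      exact fun h => scalar_two_mul_ne _ h.symm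
    rw [← huw, map_add, LinearMap.add_apply, map_smul, LinearMap.smul_apply,
      (S.mem_logicalPaulis_iff_vec.mp B.Z_mem) u hu, zero_add, smul_eq_mul] at h1
    exact (mul_eq_zero.mp h1).resolve_right h2
  rw [hc, zero_smul, add_zero] at huw
  exact S.vec_mem_binarySpace_iff.mp (huw ▸ hu)

/-- The logical operators of a code with one logical qubit are generated by the stabilizers, the
phases, `X̄` and `Z̄`. -/
theorem exists_eq_scalar_mul_pauli_mul {S : StabilizerCode Q} (hk : S.Encodes 1)
    (B : LogicalQubit S) {L : PauliOp Q} (hL : L ∈ S.logicalPaulis) :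
    ∃ (k : ZMod 4) (a b : ZMod 2), ∃ t ∈ S.group, L = scalar k * (B.pauli a b * t) := by
  have hanti : B.Z * B.X ≠ B.X * B.Z := by
    rw [B.anticomm]; exact scalar_two_mul_ne _
  have h01 : symplecticForm Q B.X.vec B.Z.vec = 1 := by
    have h2 : ∀ e : ZMod 2, e ≠ 0 → e = 1 := by decide
    refine h2 _ ?_
    rw [Ne, ← mul_comm_iff_symplecticForm]
    exact fun h => hanti h.symm
  have hself : ∀ p : PauliOp Q, symplecticForm Q p.vec p.vec = 0 := fun p =>
    (mul_comm_iff_symplecticForm p p).mp rfl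
  have h2 : ∀ e : ZMod 2, e = 0 ∨ e = 1 := by decide
  have hv1 : (1 : ZMod 2).val = 1 := rfl
  have hvec : ∀ a b : ZMod 2, (B.pauli a b).vec = a • B.X.vec + b • B.Z.vec := by
    intro a b
    have h0 : (1 : PauliOp Q).vec = 0 := rfl
    rcases h2 a with rfl | rfl <;> rcases h2 b with rfl | rfl <;>
      simp [LogicalQubit.pauli, hv1, vec_mul, h0]
  -- The exponents are read off from the commutation of `L` with `Z̄` and `X̄`.
  set a := symplecticForm Q L.vec B.Z.vec with ha
  set b := symplecticForm Q L.vec B.X.vec with hb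
  have hform : ∀ R : PauliOp Q, symplecticForm Q ((B.pauli a b)⁻¹ * L).vec R.vec
      = a * symplecticForm Q B.X.vec R.vec + b * symplecticForm Q B.Z.vec R.vec
        + symplecticForm Q L.vec R.vec := by
    intro R
    have hinv : ((B.pauli a b)⁻¹).vec = (B.pauli a b).vec := rfl
    rw [vec_mul, hinv, hvec]
    simp
  obtain ⟨k, hk⟩ := exists_scalar_mul_mem_of_commute_X_Z hk B
    (L := (B.pauli a b)⁻¹ * L) (mul_mem (inv_mem (B.pauli_mem a b)) hL)
    ((mul_comm_iff_symplecticForm _ _).mpr (by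
      rw [hform, hself, symplecticForm_comm B.Z.vec, h01, mul_zero, mul_one, zero_add]
      exact CharTwo.add_self_eq_zero _))
    ((mul_comm_iff_symplecticForm _ _).mpr (by
      rw [hform, hself, h01, mul_zero, mul_one, add_zero]
      exact CharTwo.add_self_eq_zero _))
  refine ⟨-k, a, b, _, hk, ?_⟩
  rw [← mul_assoc (B.pauli a b), ← scalar_comm, mul_assoc, mul_inv_cancel_left,
    scalar_neg_mul_cancel]

end Logical

section Distance

variable {Q : Type*} [Fintype Q] (S : StabilizerCode Q)

theorem nontrivialLogicals_nonempty (h : 0 < S.minDistance) : S.nontrivialLogicals.Nonempty := by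
  by_contra hne
  rw [Set.not_nonempty_iff_eq_empty] at hne
  simp [minDistance, hne] at h

theorem distance_le_card_supp {L P : PauliOp Q} (hP : P ∈ S.representatives L) :
    S.distance L ≤ P.supp.card :=
  Nat.sInf_le (show P.supp.card ∈ {w | ∃ P ∈ S.representatives L, w = P.supp.card} from
    ⟨P, hP, rfl⟩)

theorem minDistance_le_distance {L : PauliOp Q} (hL : L ∈ S.nontrivialLogicals) :
    S.minDistance ≤ S.distance L :=
  Nat.sInf_le (show S.distance L ∈ {d | ∃ L ∈ S.nontrivialLogicals, d = S.distance L} from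
    ⟨L, hL, rfl⟩)

theorem minDistance_le_card_supp {P : PauliOp Q} (hP : P ∈ S.nontrivialLogicals) :
    S.minDistance ≤ P.supp.card :=
  (S.minDistance_le_distance hP).trans (S.distance_le_card_supp (S.self_mem_representatives P))

theorem exists_mem_representatives_card_supp_eq (L : PauliOp Q) :
    ∃ P ∈ S.representatives L, P.supp.card = S.distance L := by
  obtain ⟨P, hP, h⟩ := Nat.sInf_mem
    (s := {w | ∃ P ∈ S.representatives L, w = P.supp.card})
    ⟨_, L, S.self_mem_representatives L, rfl⟩
  exact ⟨P, hP, h.symm⟩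

theorem exists_card_supp_eq_minDistance (h : S.nontrivialLogicals.Nonempty) :
    ∃ P ∈ S.nontrivialLogicals, P.supp.card = S.minDistance := by
  obtain ⟨L₀, hL₀⟩ := h
  obtain ⟨L, hL, h⟩ := Nat.sInf_mem
    (s := {d | ∃ L ∈ S.nontrivialLogicals, d = S.distance L}) ⟨_, L₀, hL₀, rfl⟩
  obtain ⟨P, hP, hPL⟩ := S.exists_mem_representatives_card_supp_eq L
  exact ⟨P, S.mem_nontrivialLogicals_of_mem_representatives hL hP, hPL.trans h.symm⟩

theorem distance_le_card (L : PauliOp Q) : S.distance L ≤ Fintype.card Q :=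
  (S.distance_le_card_supp (S.self_mem_representatives L)).trans (Finset.card_le_univ _)

theorem distance_le_maxDistance {L : PauliOp Q} (hL : L ∈ S.nontrivialLogicals) :
    S.distance L ≤ S.maxDistance := by
  refine le_csSup ⟨Fintype.card Q, ?_⟩ ⟨L, hL, rfl⟩
  rintro _ ⟨L', -, rfl⟩
  exact S.distance_le_card L'

theorem exists_mem_representatives_card_supp_le {L : PauliOp Q} (hL : L ∈ S.nontrivialLogicals) :
    ∃ P ∈ S.representatives L, P.supp.card ≤ S.maxDistance := by
  obtain ⟨P, hP, h⟩ := S.exists_mem_representatives_card_supp_eq L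
  exact ⟨P, hP, h.trans_le (S.distance_le_maxDistance hL)⟩

theorem minDistance_le_maxDistance (h : S.nontrivialLogicals.Nonempty) :
    S.minDistance ≤ S.maxDistance :=
  let ⟨_, hL⟩ := h
  (S.minDistance_le_distance hL).trans (S.distance_le_maxDistance hL)

/-- If no non-trivial logical operator has weight one, then every operator that commutes with the
stabilizers agrees with some stabilizer at any given qubit: otherwise a single-qubit Pauli operator
would commute with all the stabilizers and not with `L`. -/
theorem exists_mem_representatives_notMem_supp (hd : 1 < S.minDistance) {L : PauliOp Q}
    (hL : L ∈ S.logicalPaulis) (q : Q) : ∃ P ∈ S.representatives L, q ∉ P.supp := by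
  classical
  -- Single-qubit Pauli operators at `q` cannot distinguish logical operators.
  have hform : ∀ (a b : ZMod 2) (p : PauliOp Q),
      symplecticForm Q p.vec (⟨0, Pi.single q a, Pi.single q b⟩ : PauliOp Q).vec
        = p.z q * a + b * p.x q := by
    intro a b p
    simp only [symplecticForm_apply, vec, Finset.sum_add_distrib]
    congr 1
    · rw [Finset.sum_eq_single q] <;> simp +contextual
    · rw [Finset.sum_eq_single q] <;> simp +contextual
  have hcomm : ∀ a b : ZMod 2, (∀ s ∈ S.group, s.z q * a + b * s.x q = 0) →
      L.z q * a + b * L.x q = 0 := by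
    intro a b h
    set P : PauliOp Q := ⟨0, Pi.single q a, Pi.single q b⟩ with hP
    have hPl : P ∈ S.logicalPaulis := S.mem_logicalPaulis_iff.mpr fun s hs =>
      ((mul_comm_iff_symplecticForm s P).mpr ((hform a b s).trans (h s hs))).symm
    have hsupp : P.supp ⊆ {q} := by
      intro r hr
      rw [mem_supp] at hr
      by_contra hrq
      rw [Finset.mem_singleton] at hrq
      simp [hP, hrq] at hr
    have hPt : P ∉ S.nontrivialLogicals := fun hc => by
      have h1 := S.minDistance_le_card_supp hc
      have h2 := Finset.card_le_card hsupp
      rw [Finset.card_singleton] at h2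
      omega
    obtain ⟨k, hk⟩ := S.exists_scalar_mul_mem hPl hPt
    rw [← hform, ← mul_comm_iff_symplecticForm, eq_comm, ← scalar_mul_comm_iff k, eq_comm]
    exact S.commute_of_mem hL hk
  have hex : ∃ s ∈ S.group, s.x q = L.x q ∧ s.z q = L.z q := by
    by_contra hno
    push Not at hno
    -- The values of the stabilizers at `q` form a proper subgroup, which is trivial or has a
    -- single non-zero element `(x, z)`.
    by_cases htriv : ∀ s ∈ S.group, s.x q = 0 ∧ s.z q = 0
    · have h1 := hcomm 1 0 fun s hs => by simp [htriv s hs]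
      have h2 := hcomm 0 1 fun s hs => by simp [htriv s hs]
      exact hno 1 (one_mem _) (by simpa [eq_comm] using h2) (by simpa [eq_comm] using h1)
    · push Not at htriv
      obtain ⟨s, hs, hs0⟩ := htriv
      have key : ∀ x z x' z' lx lz : ZMod 2, (x = 0 → z ≠ 0) → (x = lx → z ≠ lz) →
          (x' = lx → z' ≠ lz) → (x + x' = lx → z + z' ≠ lz) → (0 = lx → 0 ≠ lz) →
          z' * x + z * x' = 0 := by decide
      have key' : ∀ x z lx lz : ZMod 2, (x = 0 → z ≠ 0) → (x = lx → z ≠ lz) →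
          (0 = lx → 0 ≠ lz) → lz * x + z * lx ≠ 0 := by decide
      refine key' _ _ _ _ hs0 (hno s hs) (by simpa using hno 1 (one_mem _))
        (hcomm (s.x q) (s.z q) fun t ht => ?_)
      exact key _ _ _ _ _ _ hs0 (hno s hs) (hno t ht) (hno (s * t) (mul_mem hs ht))
        (by simpa using hno 1 (one_mem _))
  obtain ⟨s, hs, hx, hz⟩ := hex
  refine ⟨L * s, ⟨s, hs, rfl⟩, ?_⟩
  simp [mem_supp, hx, hz, CharTwo.add_self_eq_zero]

end Distance

end StabilizerCode

/-! ### Logical operators of a concatenated code -/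

namespace PauliOp

section Blocks

variable {Q₁ Q₂ : Type*}

/-- The part of a Pauli operator in a given block of qubits, with trivial phase. -/
def block (P : PauliOp (Q₁ × Q₂)) (q : Q₁) : PauliOp Q₂ :=
  ⟨0, fun r => P.x (q, r), fun r => P.z (q, r)⟩

variable [Fintype Q₁] [Fintype Q₂]

theorem eq_scalar_mul_blockTensor_block (P : PauliOp (Q₁ × Q₂)) :
    P = scalar P.phase * blockTensor P.block := by
  refine ext_xz ?_ ?_ ?_
  · rw [scalar_mul_x]; rfl
  · rw [scalar_mul_z]; rfl
  · rw [scalar_mul_phase]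
    simp [blockTensor, block]

theorem card_supp_blockTensor (g : Q₁ → PauliOp Q₂) :
    (blockTensor g).supp.card = ∑ q, (g q).supp.card := by
  classical
  simp only [Finset.card_eq_sum_ones, supp, Finset.sum_filter, Fintype.sum_prod_type]
  rfl

theorem blockTensor_mul_comm_iff_of_mulSingle [DecidableEq Q₁] {g : Q₁ → PauliOp Q₂} {q : Q₁}
    {t : PauliOp Q₂} :
    blockTensor g * blockTensor (Pi.mulSingle q t) = blockTensor (Pi.mulSingle q t) * blockTensor g
      ↔ g q * t = t * g q := by
  constructor
  · intro h
    refine (mul_eq_or (g q) t).resolve_right fun hanti => ?_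
    have h1 : g * Pi.mulSingle q t
        = fun r => scalar (if r = q then 2 else 0) * (Pi.mulSingle q t * g : Q₁ → PauliOp Q₂) r := by
      funext r
      by_cases hr : r = q
      · subst hr; simpa using hanti
      · simp [hr, scalar_zero]
    rw [← map_mul, ← map_mul, h1, blockTensor_scalar_mul, Finset.sum_ite_eq' Finset.univ q,
      if_pos (Finset.mem_univ q)] at h
    exact scalar_two_mul_ne _ h
  · intro h
    rw [← map_mul, ← map_mul]
    congr 1
    funext r
    by_cases hr : r = q
    · subst hr; simpa using h
    · simp [hr]

end Blocks

end PauliOp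

namespace LogicalQubit

open PauliOp

variable {Q₁ Q₂ : Type*} [Fintype Q₁] [Fintype Q₂] {S₂ : StabilizerCode Q₂}

theorem pauli_zero_zero (B : LogicalQubit S₂) : B.pauli 0 0 = 1 := by simp [pauli]

theorem encode_apply (B : LogicalQubit S₂) (p : PauliOp Q₁) :
    B.encode p = scalar p.phase * blockTensor fun q => B.pauli (p.x q) (p.z q) := rfl

theorem encode_scalar (B : LogicalQubit S₂) (k : ZMod 4) :
    B.encode (scalar k : PauliOp Q₁) = scalar k := by
  have h : (fun _ : Q₁ => B.pauli 0 0) = 1 := by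
    funext q; exact B.pauli_zero_zero
  rw [encode_apply]
  change scalar k * blockTensor (fun _ : Q₁ => B.pauli 0 0) = _
  rw [h, map_one, mul_one]

theorem encode_mul_blockTensor (B : LogicalQubit S₂) (p : PauliOp Q₁) (t : Q₁ → PauliOp Q₂) :
    B.encode p * blockTensor t
      = scalar p.phase * blockTensor fun q => B.pauli (p.x q) (p.z q) * t q := by
  rw [encode_apply, mul_assoc, ← map_mul]
  rfl

theorem encode_comm_iff (B : LogicalQubit S₂) (p r : PauliOp Q₁) :
    B.encode p * B.encode r = B.encode r * B.encode p ↔ p * r = r * p := by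
  refine ⟨fun h => ?_, fun h => by rw [← map_mul, h, map_mul]⟩
  refine (mul_eq_or p r).resolve_right fun hanti => ?_
  rw [← map_mul, hanti, map_mul, encode_scalar, ← map_mul] at h
  exact scalar_two_mul_ne _ h

end LogicalQubit

namespace StabilizerCode

open PauliOp

section ConcatLogical

variable {Q₁ Q₂ : Type*} [Fintype Q₁] [Fintype Q₂] {S₁ : StabilizerCode Q₁}
  {S₂ : StabilizerCode Q₂} {B : LogicalQubit S₂}

theorem encode_mem_concat {s : PauliOp Q₁} (hs : s ∈ S₁.group) :
    B.encode s ∈ (S₁.concat S₂ B).group :=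
  mem_concatGroup.mpr ⟨s, hs, 1, fun _ => one_mem _, by rw [map_one, mul_one]⟩

theorem blockTensor_mem_concat {t : Q₁ → PauliOp Q₂} (ht : ∀ q, t q ∈ S₂.group) :
    blockTensor t ∈ (S₁.concat S₂ B).group :=
  mem_concatGroup.mpr ⟨1, one_mem _, t, ht, by rw [map_one, one_mul]⟩

theorem encode_mem_concat_iff {p : PauliOp Q₁} :
    B.encode p ∈ (S₁.concat S₂ B).group ↔ p ∈ S₁.group := by
  refine ⟨fun h => ?_, encode_mem_concat⟩
  obtain ⟨s, hs, t, ht, h⟩ := mem_concatGroup.mp h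
  rw [← inv_mul_eq_iff_eq_mul, ← map_inv, ← map_mul] at h
  set N := s⁻¹ * p with hN
  have hxz : ∀ q, N.x q = 0 ∧ N.z q = 0 := by
    intro q
    have h1 : B.pauli (N.x q) (N.z q)
        = scalar ((B.pauli (N.x q) (N.z q)).phase - (t q).phase) * t q := by
      refine eq_scalar_mul_of_x_eq_of_z_eq (funext fun r => ?_) (funext fun r => ?_)
      · have := congrFun (congrArg x h) (q, r)
        rwa [LogicalQubit.encode_apply, scalar_mul_x] at this
      · have := congrFun (congrArg z h) (q, r)
        rwa [LogicalQubit.encode_apply, scalar_mul_z] at this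
    exact eq_zero_of_pauli_mul_mem B (inv_mem (ht q)) (mul_inv_eq_of_eq_mul h1)
  have hNs : N = scalar N.phase :=
    ext_xz (funext fun q => (hxz q).1) (funext fun q => (hxz q).2) rfl
  have hmem : (scalar N.phase : PauliOp (Q₁ × Q₂)) ∈ (S₁.concat S₂ B).group := by
    rw [← B.encode_scalar, ← hNs, h]
    exact blockTensor_mem_concat ht
  rw [(S₁.concat S₂ B).scalar_mem hmem, scalar_zero, hN, inv_mul_eq_one] at hNs
  exact hNs ▸ hs

theorem encode_mul_blockTensor_mem_logicalPaulis_iff {p : PauliOp Q₁} {t : Q₁ → PauliOp Q₂}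
    (ht : ∀ q, t q ∈ S₂.group) :
    B.encode p * blockTensor t ∈ (S₁.concat S₂ B).logicalPaulis ↔ p ∈ S₁.logicalPaulis := by
  rw [Subgroup.mul_mem_cancel_right _ (group_le_logicalPaulis _ (blockTensor_mem_concat ht)),
    mem_logicalPaulis_iff, mem_logicalPaulis_iff]
  constructor
  · intro h s hs
    exact (B.encode_comm_iff p s).mp (h _ (encode_mem_concat hs))
  · intro h g hg
    obtain ⟨s, hs, t', ht', rfl⟩ := mem_concatGroup.mp hg
    rw [← mul_assoc, (B.encode_comm_iff p s).mpr (h s hs), mul_assoc, encode_comm S₂ B p t' ht',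
      mul_assoc]

theorem encode_mul_blockTensor_mem_nontrivialLogicals_iff {p : PauliOp Q₁} {t : Q₁ → PauliOp Q₂}
    (ht : ∀ q, t q ∈ S₂.group) :
    B.encode p * blockTensor t ∈ (S₁.concat S₂ B).nontrivialLogicals
      ↔ p ∈ S₁.nontrivialLogicals := by
  refine and_congr (encode_mul_blockTensor_mem_logicalPaulis_iff ht) (forall_congr' fun k => ?_)
  rw [← mul_assoc, Subgroup.mul_mem_cancel_right _ (blockTensor_mem_concat ht), ← B.encode_scalar,
    ← map_mul, encode_mem_concat_iff]

/-- Each block of a logical operator of the concatenated code is a logical operator of the inner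
code, which determines a Pauli operator of one qubit of the outer code. -/
theorem exists_eq_encode_mul_blockTensor (hk₂ : S₂.Encodes 1) {L : PauliOp (Q₁ × Q₂)}
    (hL : L ∈ (S₁.concat S₂ B).logicalPaulis) :
    ∃ (p : PauliOp Q₁) (t : Q₁ → PauliOp Q₂), (∀ q, t q ∈ S₂.group) ∧
      L = B.encode p * blockTensor t := by
  classical
  have hblock : ∀ q, L.block q ∈ S₂.logicalPaulis := fun q =>
    S₂.mem_logicalPaulis_iff.mpr fun s hs => by
      have h1 := (S₁.concat S₂ B).commute_of_mem hL
        (blockTensor_mem_concat (t := Pi.mulSingle q s) fun r => by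
          by_cases hr : r = q
          · subst hr; simpa using hs
          · simp [hr, one_mem])
      rwa [eq_scalar_mul_blockTensor_block L, scalar_mul_comm_iff,
        blockTensor_mul_comm_iff_of_mulSingle] at h1
  choose k a b t ht h using fun q => exists_eq_scalar_mul_pauli_mul hk₂ B (hblock q)
  refine ⟨⟨L.phase + ∑ q, k q, a, b⟩, t, ht, ?_⟩
  rw [LogicalQubit.encode_mul_blockTensor, ← scalar_mul_scalar, mul_assoc,
    ← blockTensor_scalar_mul]
  conv_lhs => rw [eq_scalar_mul_blockTensor_block L]
  congr 2
  funext q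
  exact h q

theorem exists_nontrivial_eq_encode_mul_blockTensor (hk₂ : S₂.Encodes 1) {L : PauliOp (Q₁ × Q₂)}
    (hL : L ∈ (S₁.concat S₂ B).nontrivialLogicals) :
    ∃ p ∈ S₁.nontrivialLogicals, ∃ t : Q₁ → PauliOp Q₂, (∀ q, t q ∈ S₂.group) ∧
      L = B.encode p * blockTensor t := by
  obtain ⟨p, t, ht, rfl⟩ := exists_eq_encode_mul_blockTensor hk₂ hL.1
  exact ⟨p, (encode_mul_blockTensor_mem_nontrivialLogicals_iff ht).mp hL, t, ht, rfl⟩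

theorem concat_nontrivialLogicals_nonempty (h : S₁.nontrivialLogicals.Nonempty) :
    (S₁.concat S₂ B).nontrivialLogicals.Nonempty := by
  obtain ⟨p, hp⟩ := h
  exact ⟨_, (encode_mul_blockTensor_mem_nontrivialLogicals_iff (B := B)
    (t := 1) fun _ => one_mem _).mpr hp⟩

theorem scalar_mul_blockTensor_mem_representatives {p p' : PauliOp Q₁} {t r : Q₁ → PauliOp Q₂}
    (ht : ∀ q, t q ∈ S₂.group) (hp' : p' ∈ S₁.representatives p)
    (hr : ∀ q, r q ∈ S₂.representatives (B.pauli (p'.x q) (p'.z q))) :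
    scalar p'.phase * blockTensor r
      ∈ (S₁.concat S₂ B).representatives (B.encode p * blockTensor t) := by
  obtain ⟨s, hs, rfl⟩ := hp'
  choose u hu hru using hr
  refine ⟨(blockTensor t)⁻¹ * (B.encode s * blockTensor u), mul_mem
    (inv_mem (blockTensor_mem_concat ht))
    (mul_mem (encode_mem_concat hs) (blockTensor_mem_concat hu)), ?_⟩
  rw [mul_assoc, mul_inv_cancel_left, ← mul_assoc, ← map_mul, LogicalQubit.encode_mul_blockTensor,
    ← funext hru]

theorem minDistance_mul_le_concat (hk₂ : S₂.Encodes 1) (h : S₁.nontrivialLogicals.Nonempty) :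
    S₁.minDistance * S₂.minDistance ≤ (S₁.concat S₂ B).minDistance := by
  obtain ⟨L, hL, hLd⟩ :=
    exists_card_supp_eq_minDistance _ (concat_nontrivialLogicals_nonempty (S₂ := S₂) (B := B) h)
  rw [← hLd]
  obtain ⟨p, hp, t, ht, rfl⟩ := exists_nontrivial_eq_encode_mul_blockTensor hk₂ hL
  rw [LogicalQubit.encode_mul_blockTensor, supp_scalar_mul, card_supp_blockTensor]
  calc S₁.minDistance * S₂.minDistance ≤ p.supp.card * S₂.minDistance :=
        Nat.mul_le_mul_right _ (S₁.minDistance_le_card_supp hp)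
    _ = ∑ _q ∈ p.supp, S₂.minDistance := by rw [Finset.sum_const, smul_eq_mul]
    _ ≤ ∑ q ∈ p.supp, (B.pauli (p.x q) (p.z q) * t q).supp.card := by
        refine Finset.sum_le_sum fun q hq => S₂.minDistance_le_card_supp ?_
        exact S₂.mul_mem_nontrivialLogicals
          (pauli_mem_nontrivialLogicals B (mem_supp.mp hq)) (ht q)
    _ ≤ _ := Finset.sum_le_sum_of_subset (Finset.subset_univ _)

theorem concat_maxDistance_le (hk₂ : S₂.Encodes 1) :
    (S₁.concat S₂ B).maxDistance ≤ S₁.maxDistance * S₂.maxDistance := by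
  classical
  refine csSup_le' ?_
  rintro _ ⟨L, hL, rfl⟩
  obtain ⟨p, hp, t, ht, rfl⟩ := exists_nontrivial_eq_encode_mul_blockTensor hk₂ hL
  obtain ⟨p', hp', hcard⟩ := S₁.exists_mem_representatives_card_supp_le hp
  have hex : ∀ q, ∃ P ∈ S₂.representatives (B.pauli (p'.x q) (p'.z q)),
      P.supp.card ≤ if q ∈ p'.supp then S₂.maxDistance else 0 := by
    intro q
    by_cases hq : q ∈ p'.supp
    · simp only [if_pos hq]
      exact S₂.exists_mem_representatives_card_supp_le
        (pauli_mem_nontrivialLogicals B (mem_supp.mp hq))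
    · refine ⟨_, S₂.self_mem_representatives _, ?_⟩
      simp only [if_neg hq]
      rw [mem_supp, not_or, not_not, not_not] at hq
      rw [hq.1, hq.2, B.pauli_zero_zero, supp_one, Finset.card_empty]
  choose r hr hrcard using hex
  refine (distance_le_card_supp _
    (scalar_mul_blockTensor_mem_representatives ht hp' hr)).trans ?_
  rw [supp_scalar_mul, card_supp_blockTensor]
  refine (Finset.sum_le_sum fun q _ => hrcard q).trans ?_
  rw [Finset.sum_ite_mem, Finset.univ_inter, Finset.sum_const, smul_eq_mul]
  exact Nat.mul_le_mul_right _ hcard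

end ConcatLogical

end StabilizerCode

/-! ### Disjointness -/

namespace StabilizerCode

open PauliOp

section Disjointness

variable {Q : Type*} [Fintype Q] (S : StabilizerCode Q)

/-- A `c`-disjoint collection of representatives of `L`, as a finite indexed family. -/
def IsDisjointFamily {ι : Type*} [Fintype ι] (c : ℕ) (L : PauliOp Q) (f : ι → PauliOp Q) : Prop :=
  (∀ i, f i ∈ S.representatives L) ∧
    ∀ q : Q, (Finset.univ.filter fun i => (f i).x q ≠ 0 ∨ (f i).z q ≠ 0).card ≤ c

variable {S}

theorem IsDisjointFamily.isDisjointCollection {ι : Type*} [Fintype ι] {c : ℕ} {L : PauliOp Q}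
    {f : ι → PauliOp Q} (hf : S.IsDisjointFamily c L f) :
    S.IsDisjointCollection c L (Finset.univ.val.map f) := by
  refine ⟨fun P hP => ?_, fun q => ?_⟩
  · obtain ⟨i, -, rfl⟩ := Multiset.mem_map.mp hP
    exact hf.1 i
  · rw [Multiset.filter_map, Multiset.card_map]
    exact hf.2 q

theorem IsDisjointCollection.exists_isDisjointFamily {c : ℕ} {L : PauliOp Q}
    {A : Multiset (PauliOp Q)} (hA : S.IsDisjointCollection c L A) :
    ∃ f : Fin A.card → PauliOp Q, S.IsDisjointFamily c L f := by
  induction A using Quot.inductionOn with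
  | h l =>
    have h1 : (Finset.univ : Finset (Fin l.length)).val.map l.get = (l : Multiset (PauliOp Q)) := by
      rw [Fin.univ_val_map, List.ofFn_get]
    refine ⟨l.get, fun i => hA.1 _ (List.get_mem l i), fun q => ?_⟩
    have h2 := hA.2 q
    change (Multiset.filter _ (l : Multiset (PauliOp Q))).card ≤ c at h2
    rw [← h1, Multiset.filter_map, Multiset.card_map] at h2
    exact h2

theorem IsDisjointFamily.comp {ι κ : Type*} [Fintype ι] [Fintype κ] {c : ℕ} {L : PauliOp Q}
    {f : ι → PauliOp Q} (hf : S.IsDisjointFamily c L f) (e : κ ↪ ι) :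
    S.IsDisjointFamily c L (f ∘ e) := by
  refine ⟨fun i => hf.1 _, fun q => le_trans ?_ (hf.2 q)⟩
  rw [← Finset.card_map e]
  refine Finset.card_le_card fun i hi => ?_
  obtain ⟨j, hj, rfl⟩ := Finset.mem_map.mp hi
  simpa using hj

/-- Double counting of the pairs of a member of the family and a qubit of `R` in its support. -/
theorem IsDisjointFamily.sum_card_supp_inter_le [DecidableEq Q] {ι : Type*} [Fintype ι] {c : ℕ}
    {L : PauliOp Q} {f : ι → PauliOp Q} (hf : S.IsDisjointFamily c L f) (R : Finset Q) :
    ∑ i, ((f i).supp ∩ R).card ≤ R.card * c := by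
  have h1 : ∀ i, ((f i).supp ∩ R).card
      = ∑ q ∈ R, if (f i).x q ≠ 0 ∨ (f i).z q ≠ 0 then 1 else 0 := by
    intro i
    rw [Finset.inter_comm, ← Finset.filter_mem_eq_inter, Finset.card_filter]
    simp only [mem_supp]
  simp only [h1]
  rw [Finset.sum_comm, ← smul_eq_mul, ← Finset.sum_const]
  refine Finset.sum_le_sum fun q _ => ?_
  rw [← Finset.card_filter]
  exact hf.2 q

variable (S) in
theorem supp_nonempty {P : PauliOp Q} (hP : P ∈ S.nontrivialLogicals) : P.supp.Nonempty := by
  by_contra h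
  rw [Finset.not_nonempty_iff_eq_empty] at h
  have h0 : ∀ q, P.x q = 0 ∧ P.z q = 0 := fun q => by
    have : q ∉ P.supp := by simp [h]
    rwa [mem_supp, not_or, not_not, not_not] at this
  refine hP.2 (-P.phase) ?_
  have h1 : P = scalar P.phase :=
    ext_xz (funext fun q => (h0 q).1) (funext fun q => (h0 q).2) rfl
  rw [h1, scalar_phase, scalar_mul_scalar, neg_add_cancel, scalar_zero]
  exact one_mem _

theorem IsDisjointFamily.card_le {ι : Type*} [Fintype ι] {c : ℕ} {L : PauliOp Q}
    (hL : L ∈ S.nontrivialLogicals) {f : ι → PauliOp Q} (hf : S.IsDisjointFamily c L f) :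
    Fintype.card ι ≤ Fintype.card Q * c := by
  classical
  refine le_trans ?_ (hf.sum_card_supp_inter_le Finset.univ)
  rw [Fintype.card, Finset.card_eq_sum_ones]
  refine Finset.sum_le_sum fun i _ => ?_
  rw [Finset.inter_univ]
  exact (S.supp_nonempty (S.mem_nontrivialLogicals_of_mem_representatives hL (hf.1 i))).card_pos

theorem IsDisjointCollection.card_le {c : ℕ} {L : PauliOp Q} (hL : L ∈ S.nontrivialLogicals)
    {A : Multiset (PauliOp Q)} (hA : S.IsDisjointCollection c L A) :
    A.card ≤ Fintype.card Q * c := by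
  obtain ⟨f, hf⟩ := hA.exists_isDisjointFamily
  simpa using hf.card_le hL

variable (S)

theorem cDisjointness_nonneg (c : ℕ) (L : PauliOp Q) : 0 ≤ S.cDisjointness c L := by
  unfold cDisjointness; positivity

theorem exists_isDisjointFamily_card (c : ℕ+) {L : PauliOp Q} (hL : L ∈ S.nontrivialLogicals) :
    ∃ (m : ℕ) (f : Fin m → PauliOp Q), S.IsDisjointFamily c L f ∧
      (m : ℝ) = c * S.cDisjointness c L := by
  obtain ⟨A, hA, h⟩ := Nat.sSup_mem
    (s := {m | ∃ A, S.IsDisjointCollection c L A ∧ m = A.card})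
    ⟨0, 0, ⟨by simp, by simp⟩, by simp⟩
    ⟨Fintype.card Q * c, by rintro _ ⟨A, hA, rfl⟩; exact hA.card_le hL⟩
  obtain ⟨f, hf⟩ := hA.exists_isDisjointFamily
  refine ⟨_, f, hf, ?_⟩
  rw [cDisjointness, h, mul_inv_cancel_left₀ (by simp)]

theorem card_le_mul_cDisjointness {ι : Type*} [Fintype ι] (c : ℕ+) {L : PauliOp Q}
    (hL : L ∈ S.nontrivialLogicals) {f : ι → PauliOp Q} (hf : S.IsDisjointFamily c L f) :
    (Fintype.card ι : ℝ) ≤ c * S.cDisjointness c L := by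
  rw [cDisjointness, mul_inv_cancel_left₀ (by simp), Nat.cast_le]
  refine le_csSup ⟨Fintype.card Q * c, ?_⟩ ⟨_, hf.isDisjointCollection, ?_⟩
  · rintro _ ⟨A, hA, rfl⟩
    exact hA.card_le hL
  · simp

theorem iInf_cDisjointness_nonneg (c : ℕ) :
    0 ≤ ⨅ L : S.nontrivialLogicals, S.cDisjointness c L :=
  Real.iInf_nonneg fun L => S.cDisjointness_nonneg c L

theorem iInf_cDisjointness_le (c : ℕ) {L : PauliOp Q} (hL : L ∈ S.nontrivialLogicals) :
    ⨅ L : S.nontrivialLogicals, S.cDisjointness c L ≤ S.cDisjointness c L :=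
  ciInf_le ⟨0, by rintro _ ⟨L, rfl⟩; exact S.cDisjointness_nonneg c L⟩
    (⟨L, hL⟩ : S.nontrivialLogicals)

/-- Every non-trivial logical operator has a `c`-disjoint family of representatives, of a size
that does not depend on the operator and that bounds the minimal `c`-disjointness. -/
theorem exists_forall_isDisjointFamily (c : ℕ+) :
    ∃ m : ℕ, c * (⨅ L : S.nontrivialLogicals, S.cDisjointness c L) ≤ m ∧
      ∀ L ∈ S.nontrivialLogicals, ∃ f : Fin m → PauliOp Q, S.IsDisjointFamily c L f := by
  refine ⟨⌈c * (⨅ L : S.nontrivialLogicals, S.cDisjointness c L)⌉₊, Nat.le_ceil _, ?_⟩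
  intro L hL
  obtain ⟨m, f, hf, hm⟩ := S.exists_isDisjointFamily_card c hL
  have hle : ⌈c * (⨅ L : S.nontrivialLogicals, S.cDisjointness c L)⌉₊ ≤ m := by
    refine Nat.ceil_le.mpr ?_
    rw [hm]
    exact mul_le_mul_of_nonneg_left (S.iInf_cDisjointness_le c hL) (by positivity)
  exact ⟨_, hf.comp (Fin.castLEEmb hle)⟩

theorem disjointness_bddAbove (h : S.nontrivialLogicals.Nonempty) :
    BddAbove (Set.range fun c : ℕ+ => ⨅ L : S.nontrivialLogicals, S.cDisjointness c L) := by
  obtain ⟨L, hL⟩ := h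
  refine ⟨Fintype.card Q, ?_⟩
  rintro _ ⟨c, rfl⟩
  refine (S.iInf_cDisjointness_le c hL).trans ?_
  obtain ⟨m, f, hf, hm⟩ := S.exists_isDisjointFamily_card c hL
  have h1 := hf.card_le hL
  rw [Fintype.card_fin] at h1
  have h2 : (m : ℝ) ≤ Fintype.card Q * c := by exact_mod_cast h1
  have hc : (0 : ℝ) < c := by exact_mod_cast c.pos
  rw [hm, mul_comm] at h2
  exact le_of_mul_le_mul_right h2 hc

theorem iInf_cDisjointness_le_disjointness (h : S.nontrivialLogicals.Nonempty) (c : ℕ+) :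
    ⨅ L : S.nontrivialLogicals, S.cDisjointness c L ≤ S.disjointness :=
  le_ciSup (S.disjointness_bddAbove h) c

theorem disjointness_nonneg : 0 ≤ S.disjointness :=
  Real.iSup_nonneg fun c => S.iInf_cDisjointness_nonneg c

theorem le_disjointness_of_forall_isDisjointFamily (h : S.nontrivialLogicals.Nonempty) (c : ℕ+)
    {m : ℕ} (hm : ∀ L ∈ S.nontrivialLogicals, ∃ (ι : Type) (_ : Fintype ι) (f : ι → PauliOp Q),
      Fintype.card ι = m ∧ S.IsDisjointFamily c L f) :
    (m : ℝ) / c ≤ S.disjointness := by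
  have : Nonempty S.nontrivialLogicals := h.to_subtype
  refine le_trans (le_ciInf fun L => ?_) (S.iInf_cDisjointness_le_disjointness h c)
  obtain ⟨ι, _, f, hι, hf⟩ := hm L L.2
  rw [div_le_iff₀' (by exact_mod_cast c.pos), ← hι]
  exact S.card_le_mul_cDisjointness c L.2 hf

/-- Scrubbing: a non-trivial logical operator has a representative whose support contains at most
a fraction `1 / Δ` of a given region. -/
theorem exists_mem_representatives_card_supp_inter_le [DecidableEq Q] {L : PauliOp Q}
    (hL : L ∈ S.nontrivialLogicals) (R : Finset Q) :
    ∃ P ∈ S.representatives L, ((P.supp ∩ R).card : ℝ) * S.disjointness ≤ R.card := by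
  -- A representative with the smallest possible overlap works for all `c` at once, so that it
  -- does not matter whether the supremum in the definition of `Δ` is attained.
  obtain ⟨P, hP, hmin⟩ := Nat.sInf_mem
    (s := {w | ∃ P ∈ S.representatives L, w = (P.supp ∩ R).card})
    ⟨_, L, S.self_mem_representatives L, rfl⟩
  refine ⟨P, hP, ?_⟩
  rw [disjointness, Real.mul_iSup_of_nonneg (Nat.cast_nonneg _)]
  refine ciSup_le fun c => ?_
  obtain ⟨m, hm, hfam⟩ := S.exists_forall_isDisjointFamily c
  obtain ⟨f, hf⟩ := hfam L hL
  have h1 : (P.supp ∩ R).card * m ≤ R.card * c := by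
    refine le_trans ?_ (hf.sum_card_supp_inter_le R)
    calc (P.supp ∩ R).card * m = ∑ _i : Fin m, (P.supp ∩ R).card := by
          rw [Finset.sum_const, Finset.card_univ, Fintype.card_fin, smul_eq_mul, mul_comm]
      _ ≤ _ := Finset.sum_le_sum fun i _ => by
          rw [← hmin]
          exact Nat.sInf_le ⟨_, hf.1 i, rfl⟩
  have h2 : ((P.supp ∩ R).card : ℝ) * m ≤ R.card * c := by exact_mod_cast h1
  have hc : (0 : ℝ) < c := by exact_mod_cast c.pos
  refine le_of_mul_le_mul_right (le_trans ?_ h2) hc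
  rw [mul_assoc, mul_comm _ (c : ℝ)]
  exact mul_le_mul_of_nonneg_left hm (Nat.cast_nonneg _)

/-- Choosing for each qubit a representative that avoids it gives `n` representatives, at most
`n - 1` of which are supported on any given qubit. -/
theorem one_lt_disjointness (hd : 1 < S.minDistance) : 1 < S.disjointness := by
  classical
  have hne := S.nontrivialLogicals_nonempty (zero_lt_one.trans hd)
  have ⟨L₀, hL₀⟩ := hne
  have hn : 1 < Fintype.card Q :=
    hd.trans_le ((S.minDistance_le_card_supp hL₀).trans (Finset.card_le_univ _))
  let e := (Fintype.equivFin Q).symm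
  have h1 := S.le_disjointness_of_forall_isDisjointFamily hne
    ⟨Fintype.card Q - 1, Nat.sub_pos_of_lt hn⟩ (m := Fintype.card Q) fun L hL => by
      choose f hf hfq using S.exists_mem_representatives_notMem_supp hd hL.1
      refine ⟨Fin (Fintype.card Q), inferInstance, f ∘ e, Fintype.card_fin _, fun i => hf _, ?_⟩
      intro q
      have hcard : (Finset.univ.erase (e.symm q)).card = Fintype.card Q - 1 := by
        rw [Finset.card_erase_of_mem (Finset.mem_univ _), Finset.card_univ, Fintype.card_fin]
      rw [PNat.mk_coe, ← hcard]
      refine Finset.card_le_card fun i hi => ?_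
      rw [Finset.mem_erase]
      refine ⟨?_, Finset.mem_univ _⟩
      rintro rfl
      refine hfq q (mem_supp.mpr ?_)
      simpa using hi
  refine lt_of_lt_of_le ?_ h1
  rw [PNat.mk_coe, Nat.cast_sub hn.le, Nat.cast_one, lt_div_iff₀]
  · linarith
  · have : (1 : ℝ) < Fintype.card Q := by exact_mod_cast hn
    linarith

end Disjointness

section ConcatDisjointness

variable {Q₁ Q₂ : Type*} [Fintype Q₁] [Fintype Q₂] {S₁ : StabilizerCode Q₁}
  {S₂ : StabilizerCode Q₂} {B : LogicalQubit S₂}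

/-- The members of a disjoint family for the outer code are encoded in all the ways given by
disjoint families of the logical operators of the inner code. -/
theorem exists_isDisjointFamily_concat (hk₂ : S₂.Encodes 1) {c₁ c₂ m₁ m₂ : ℕ}
    (h₁ : ∀ L ∈ S₁.nontrivialLogicals, ∃ f : Fin m₁ → PauliOp Q₁, S₁.IsDisjointFamily c₁ L f)
    (h₂ : ∀ L ∈ S₂.nontrivialLogicals, ∃ f : Fin m₂ → PauliOp Q₂, S₂.IsDisjointFamily c₂ L f)
    {L : PauliOp (Q₁ × Q₂)} (hL : L ∈ (S₁.concat S₂ B).nontrivialLogicals) :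
    ∃ f : Fin m₁ × Fin m₂ → PauliOp (Q₁ × Q₂),
      (S₁.concat S₂ B).IsDisjointFamily (c₁ * c₂) L f := by
  classical
  obtain ⟨p, hp, t, ht, rfl⟩ := exists_nontrivial_eq_encode_mul_blockTensor hk₂ hL
  obtain ⟨f, hf⟩ := h₁ p hp
  have hex : ∀ a b : ZMod 2, ∃ g : Fin m₂ → PauliOp Q₂,
      (∀ j, g j ∈ S₂.representatives (B.pauli a b)) ∧
      ∀ r, (Finset.univ.filter fun j => (g j).x r ≠ 0 ∨ (g j).z r ≠ 0).card
        ≤ if a ≠ 0 ∨ b ≠ 0 then c₂ else 0 := by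
    intro a b
    by_cases hab : a ≠ 0 ∨ b ≠ 0
    · simp only [if_pos hab]
      exact h₂ _ (pauli_mem_nontrivialLogicals B hab)
    · simp only [if_neg hab]
      refine ⟨fun _ => B.pauli a b, fun _ => S₂.self_mem_representatives _, fun r => ?_⟩
      rw [not_or, not_not, not_not] at hab
      rw [hab.1, hab.2, B.pauli_zero_zero]
      simp
  choose g hg hgc using hex
  refine ⟨fun i => scalar (f i.1).phase
    * blockTensor fun q => g ((f i.1).x q) ((f i.1).z q) i.2, fun i => ?_, ?_⟩
  · exact scalar_mul_blockTensor_mem_representatives ht (hf.1 i.1) fun q => hg _ _ _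
  · rintro ⟨q, r⟩
    simp only [scalar_mul_x, scalar_mul_z]
    rw [Finset.card_filter, Fintype.sum_prod_type]
    calc _ ≤ ∑ i : Fin m₁, if (f i).x q ≠ 0 ∨ (f i).z q ≠ 0 then c₂ else 0 :=
          Finset.sum_le_sum fun i _ => by
            rw [← Finset.card_filter]
            exact hgc ((f i).x q) ((f i).z q) r
      _ = (Finset.univ.filter fun i => (f i).x q ≠ 0 ∨ (f i).z q ≠ 0).card * c₂ := by
          rw [← Finset.sum_filter, Finset.sum_const, smul_eq_mul]
      _ ≤ c₁ * c₂ := Nat.mul_le_mul_right _ (hf.2 q)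

theorem disjointness_mul_le_concat (hk₂ : S₂.Encodes 1) (hne : S₁.nontrivialLogicals.Nonempty) :
    S₁.disjointness * S₂.disjointness ≤ (S₁.concat S₂ B).disjointness := by
  conv_lhs => rw [disjointness, Real.iSup_mul_of_nonneg S₂.disjointness_nonneg]
  refine ciSup_le fun c₁ => ?_
  conv_lhs => rw [disjointness, Real.mul_iSup_of_nonneg (S₁.iInf_cDisjointness_nonneg _)]
  refine ciSup_le fun c₂ => ?_
  obtain ⟨m₁, hm₁, h₁⟩ := S₁.exists_forall_isDisjointFamily c₁
  obtain ⟨m₂, hm₂, h₂⟩ := S₂.exists_forall_isDisjointFamily c₂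
  have h := le_disjointness_of_forall_isDisjointFamily (S₁.concat S₂ B)
    (concat_nontrivialLogicals_nonempty hne) (c₁ * c₂) (m := m₁ * m₂) fun L hL => by
      obtain ⟨f, hf⟩ := exists_isDisjointFamily_concat hk₂ h₁ h₂ hL
      exact ⟨_, inferInstance, f, by simp, by simpa using hf⟩
  refine le_trans ?_ h
  have hc₁ : (0 : ℝ) < c₁ := by exact_mod_cast c₁.pos
  have hc₂ : (0 : ℝ) < c₂ := by exact_mod_cast c₂.pos
  rw [PNat.mul_coe, Nat.cast_mul, Nat.cast_mul, le_div_iff₀ (mul_pos hc₁ hc₂)]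
  calc _ = (c₁ * ⨅ L : S₁.nontrivialLogicals, S₁.cDisjointness c₁ L)
        * (c₂ * ⨅ L : S₂.nontrivialLogicals, S₂.cDisjointness c₂ L) := by ring
    _ ≤ _ := mul_le_mul hm₁ hm₂ (mul_nonneg hc₂.le (S₂.iInf_cDisjointness_nonneg _))
        (Nat.cast_nonneg _)

end ConcatDisjointness

end StabilizerCode

/-! ### Pauli operators as unitary matrices -/

section TensorOp

variable {Q : Type*} [Fintype Q]

theorem tensorOp_conjTranspose (u : Q → Matrix (Fin 2) (Fin 2) ℂ) :
    (tensorOp u).conjTranspose = tensorOp fun q => (u q).conjTranspose := by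
  ext a b
  simp [tensorOp, Matrix.conjTranspose_apply]

theorem tensorOp_mem_unitaryGroup [DecidableEq Q] {u : Q → Matrix (Fin 2) (Fin 2) ℂ}
    (hu : ∀ q, u q ∈ Matrix.unitaryGroup (Fin 2) ℂ) :
    tensorOp u ∈ Matrix.unitaryGroup (Q → Fin 2) ℂ := by
  rw [Matrix.mem_unitaryGroup_iff, Matrix.star_eq_conjTranspose, tensorOp_conjTranspose,
    tensorOp_mul]
  have h : (fun q => u q * (u q).conjTranspose) = fun _ => 1 := by
    funext q
    exact Matrix.mem_unitaryGroup_iff.mp (hu q)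
  rw [h, tensorOp_one]

theorem pauliMatrix_zero_zero : pauliMatrix 0 0 = 1 := by simp [pauliMatrix]

theorem pauliMatrix_mem_unitaryGroup (a b : ZMod 2) :
    pauliMatrix a b ∈ Matrix.unitaryGroup (Fin 2) ℂ := by
  refine mul_mem (pow_mem ?_ _) (pow_mem ?_ _) <;>
  · rw [Matrix.mem_unitaryGroup_iff, Matrix.star_eq_conjTranspose]
    ext i j
    fin_cases i <;> fin_cases j <;> simp [Matrix.mul_apply, Fin.sum_univ_two]

/-- The Pauli matrices span the matrices; the identity only needs itself. -/
theorem exists_eq_sum_smul_pauliMatrix (A : Matrix (Fin 2) (Fin 2) ℂ) :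
    ∃ c : ZMod 2 × ZMod 2 → ℂ, A = ∑ e, c e • pauliMatrix e.1 e.2 ∧
      (A = 1 → ∀ e, e ≠ 0 → c e = 0) := by
  refine ⟨fun e => if e = (0, 0) then (A 0 0 + A 1 1) / 2 else if e = (0, 1) then
    (A 0 0 - A 1 1) / 2 else if e = (1, 0) then (A 0 1 + A 1 0) / 2 else
    (A 1 0 - A 0 1) / 2, ?_, ?_⟩
  · have hv : (1 : ZMod 2).val = 1 := rfl
    have huniv : (Finset.univ : Finset (ZMod 2 × ZMod 2)) = {(0, 0), (0, 1), (1, 0), (1, 1)} := rfl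
    rw [huniv]
    ext i j
    fin_cases i <;> fin_cases j <;> simp [pauliMatrix, hv] <;> ring
  · rintro rfl e he
    have he' : e ≠ (0, 0) := he
    simp [he']

open PauliOp in
/-- A tensor product of operators that is trivial outside the region `R` is a linear combination
of Pauli operators supported on `R`. -/
theorem exists_tensorOp_eq_sum_toMatrix [DecidableEq Q] {v : Q → Matrix (Fin 2) (Fin 2) ℂ}
    {R : Finset Q} (hv : ∀ q, q ∉ R → v q = 1) :
    ∃ (T : Finset (PauliOp Q)) (c : PauliOp Q → ℂ), (∀ P ∈ T, P.supp ⊆ R) ∧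
      tensorOp v = ∑ P ∈ T, c P • P.toMatrix := by
  have hspan : tensorOp v ∈ Submodule.span ℂ (toMatrix '' {P : PauliOp Q | P.supp ⊆ R}) := by
    choose c hc hc1 using fun q => exists_eq_sum_smul_pauliMatrix (v q)
    have h1 : tensorOp v = ∑ f : Q → ZMod 2 × ZMod 2,
        (∏ q, c q (f q)) • tensorOp fun q => pauliMatrix (f q).1 (f q).2 := by
      ext a b
      conv_lhs => rw [tensorOp]
      rw [Matrix.sum_apply]
      have h2 : ∀ q, v q (a q) (b q) = ∑ e, c q e * pauliMatrix e.1 e.2 (a q) (b q) := by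
        intro q
        conv_lhs => rw [hc q]
        simp [Matrix.sum_apply]
      simp only [h2, Finset.prod_univ_sum, Fintype.piFinset_univ, Matrix.smul_apply, tensorOp,
        Finset.prod_mul_distrib, smul_eq_mul]
    rw [h1]
    refine Submodule.sum_mem _ fun f _ => ?_
    by_cases hf : ∀ q, q ∉ R → f q = 0
    · refine Submodule.smul_mem _ _ (Submodule.subset_span
        ⟨⟨0, fun q => (f q).1, fun q => (f q).2⟩, ?_, ?_⟩)
      · intro q hq
        rw [mem_supp] at hq
        by_contra hR
        simp [hf q hR] at hq
      · simp [toMatrix]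
    · push Not at hf
      obtain ⟨q, hq, hfq⟩ := hf
      rw [Finset.prod_eq_zero (Finset.mem_univ q) (hc1 q (hv q hq) _ hfq), zero_smul]
      exact Submodule.zero_mem _
  rw [Finsupp.mem_span_image_iff_linearCombination] at hspan
  obtain ⟨l, hl, hlv⟩ := hspan
  exact ⟨l.support, l, fun P hP => hl hP, hlv.symm⟩

end TensorOp

namespace PauliOp

variable {Q : Type*} [Fintype Q]

open Classical in
/-- The sign `1` or `-1` according to whether two Pauli operators commute or anticommute. -/
noncomputable def commSign (P R : PauliOp Q) : ℂ := if P * R = R * P then 1 else -1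

theorem commSign_eq_one_iff {P R : PauliOp Q} : commSign P R = 1 ↔ P * R = R * P := by
  unfold commSign
  split_ifs with h
  · simp [h]
  · simp only [h, iff_false]; norm_num

variable [DecidableEq Q]

theorem toMatrix_apply (P : PauliOp Q) :
    P.toMatrix = Complex.I ^ P.phase.val • tensorOp fun q => pauliMatrix (P.x q) (P.z q) := rfl

theorem toMatrix_scalar (k : ZMod 4) :
    (scalar k : PauliOp Q).toMatrix = Complex.I ^ k.val • 1 := by
  rw [toMatrix_apply]
  simp only [scalar_phase, scalar_x, scalar_z, Pi.zero_apply, pauliMatrix_zero_zero, tensorOp_one]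

theorem toMatrix_mem_unitaryGroup (P : PauliOp Q) :
    P.toMatrix ∈ Matrix.unitaryGroup (Q → Fin 2) ℂ := by
  have h := Matrix.mem_unitaryGroup_iff.mp (tensorOp_mem_unitaryGroup fun q =>
    pauliMatrix_mem_unitaryGroup (P.x q) (P.z q))
  rw [Matrix.mem_unitaryGroup_iff, toMatrix_apply, star_smul, smul_mul_smul_comm, h]
  simp [← mul_pow]

theorem toMatrix_mul_inv (P : PauliOp Q) : P.toMatrix * (P⁻¹).toMatrix = 1 := by
  rw [← map_mul, mul_inv_cancel, map_one]

theorem toMatrix_inv_mul (P : PauliOp Q) : (P⁻¹).toMatrix * P.toMatrix = 1 := by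
  rw [← map_mul, inv_mul_cancel, map_one]

theorem conjTranspose_toMatrix (P : PauliOp Q) : P.toMatrix.conjTranspose = (P⁻¹).toMatrix := by
  have h := Matrix.mem_unitaryGroup_iff'.mp P.toMatrix_mem_unitaryGroup
  rw [Matrix.star_eq_conjTranspose] at h
  exact left_inv_eq_right_inv h P.toMatrix_mul_inv

theorem toMatrix_mul_toMatrix (P R : PauliOp Q) :
    P.toMatrix * R.toMatrix = commSign P R • (R.toMatrix * P.toMatrix) := by
  unfold commSign
  split_ifs with h
  · rw [one_smul, ← map_mul, h, map_mul]
  · have h2 : (2 : ZMod 4).val = 2 := rfl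
    rw [← map_mul, (mul_eq_or P R).resolve_left h, map_mul, toMatrix_scalar, h2, Complex.I_sq,
      map_mul, smul_mul_assoc, one_mul]

end PauliOp

/-! ### Logical gates and the logical Clifford hierarchy -/

namespace StabilizerCode

open PauliOp Matrix

section LogicalGates

variable {Q : Type*} [Fintype Q] [DecidableEq Q] {S : StabilizerCode Q}

theorem isLogicalGate_toMatrix {P : PauliOp Q} (hP : P ∈ S.logicalPaulis) :
    S.IsLogicalGate P.toMatrix := by
  refine ⟨P.toMatrix_mem_unitaryGroup, fun ψ hψ s hs => ?_⟩
  rw [mulVec_mulVec, ← map_mul, ← S.commute_of_mem hP hs, map_mul, ← mulVec_mulVec, hψ s hs]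

theorem IsLogicalGate.mul {U V : Matrix (Q → Fin 2) (Q → Fin 2) ℂ} (hU : S.IsLogicalGate U)
    (hV : S.IsLogicalGate V) : S.IsLogicalGate (U * V) :=
  ⟨mul_mem hU.1 hV.1, fun ψ hψ => by
    rw [← mulVec_mulVec]; exact hU.2 _ (hV.2 _ hψ)⟩

theorem IsLogicalGate.conjTranspose_mul {U : Matrix (Q → Fin 2) (Q → Fin 2) ℂ}
    (hU : S.IsLogicalGate U) : Uᴴ * U = 1 := Matrix.mem_unitaryGroup_iff'.mp hU.1

theorem IsLogicalGate.mul_conjTranspose {U : Matrix (Q → Fin 2) (Q → Fin 2) ℂ}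
    (hU : S.IsLogicalGate U) : U * Uᴴ = 1 := Matrix.mem_unitaryGroup_iff.mp hU.1

/-- A unitary operator that preserves the code space maps it onto itself, as its dimension is
finite. -/
theorem IsLogicalGate.conjTranspose {U : Matrix (Q → Fin 2) (Q → Fin 2) ℂ}
    (hU : S.IsLogicalGate U) : S.IsLogicalGate Uᴴ := by
  refine ⟨Unitary.star_mem hU.1, fun ψ hψ => ?_⟩
  have hcancel : ∀ φ, Uᴴ *ᵥ (U *ᵥ φ) = φ := fun φ => by
    rw [mulVec_mulVec, hU.conjTranspose_mul, one_mulVec]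
  let f : S.codeSpace →ₗ[ℂ] S.codeSpace := U.mulVecLin.restrict hU.2
  have hf : Function.Injective f := by
    intro φ χ h
    have h1 : U *ᵥ (φ : (Q → Fin 2) → ℂ) = U *ᵥ χ := congrArg Subtype.val h
    apply Subtype.ext
    rw [← hcancel φ, h1, hcancel]
  obtain ⟨φ, hφ⟩ := LinearMap.injective_iff_surjective.mp hf ⟨ψ, hψ⟩
  have h1 : U *ᵥ (φ : (Q → Fin 2) → ℂ) = ψ := congrArg Subtype.val hφ
  rw [← h1, hcancel]
  exact φ.2

theorem IsLogicalGate.conj_toMatrix {U : Matrix (Q → Fin 2) (Q → Fin 2) ℂ}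
    (hU : S.IsLogicalGate U) {P : PauliOp Q} (hP : P ∈ S.logicalPaulis) :
    S.IsLogicalGate (U * P.toMatrix * Uᴴ) :=
  (hU.mul (isLogicalGate_toMatrix hP)).mul hU.conjTranspose

theorem toMatrix_mulVec_scalar_mul (k : ZMod 4) (P : PauliOp Q) (ψ : (Q → Fin 2) → ℂ) :
    (scalar k * P).toMatrix *ᵥ ψ = Complex.I ^ k.val • (P.toMatrix *ᵥ ψ) := by
  rw [map_mul, toMatrix_scalar, smul_mul_assoc, one_mul, smul_mulVec]

/-- A stabilizer times a phase acts on the code space as a phase. -/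
theorem exists_mulVec_eq_smul_of_scalar_mul_mem {P : PauliOp Q}
    (h : ∃ k : ZMod 4, scalar k * P ∈ S.group) :
    ∃ μ : ℂ, ∀ ψ ∈ S.codeSpace, P.toMatrix *ᵥ ψ = μ • ψ := by
  obtain ⟨k, hk⟩ := h
  refine ⟨Complex.I ^ (-k).val, fun ψ hψ => ?_⟩
  rw [← scalar_neg_mul_cancel k P, toMatrix_mulVec_scalar_mul, hψ _ hk]

theorem mulVec_eq_of_mem_representatives {L P : PauliOp Q} (hP : P ∈ S.representatives L)
    {ψ : (Q → Fin 2) → ℂ} (hψ : ψ ∈ S.codeSpace) : P.toMatrix *ᵥ ψ = L.toMatrix *ᵥ ψ := by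
  obtain ⟨s, hs, rfl⟩ := hP
  rw [map_mul, ← mulVec_mulVec, hψ s hs]

theorem mem_logicalClifford_one {U : Matrix (Q → Fin 2) (Q → Fin 2) ℂ} :
    U ∈ S.logicalClifford 1 ↔ S.IsLogicalGate U ∧ ∃ P ∈ S.logicalPaulis, ∃ c : ℂ,
      ∀ ψ ∈ S.codeSpace, U *ᵥ ψ = c • P.toMatrix *ᵥ ψ := Iff.rfl

theorem mem_logicalClifford_add_two {U : Matrix (Q → Fin 2) (Q → Fin 2) ℂ} {m : ℕ} :
    U ∈ S.logicalClifford (m + 2) ↔ S.IsLogicalGate U ∧ ∀ P ∈ S.logicalPaulis,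
      U * P.toMatrix * Uᴴ ∈ S.logicalClifford (m + 1) := Iff.rfl

theorem IsLogicalGate.conj_mulVec_congr {U V : Matrix (Q → Fin 2) (Q → Fin 2) ℂ}
    (hU : S.IsLogicalGate U) (hV : S.IsLogicalGate V)
    (h : ∀ ψ ∈ S.codeSpace, U *ᵥ ψ = V *ᵥ ψ) {P P' : PauliOp Q} (hP : P ∈ S.logicalPaulis)
    (hPP' : ∀ ψ ∈ S.codeSpace, P.toMatrix *ᵥ ψ = P'.toMatrix *ᵥ ψ) {ψ : (Q → Fin 2) → ℂ}
    (hψ : ψ ∈ S.codeSpace) :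
    (U * P.toMatrix * Uᴴ) *ᵥ ψ = (V * P'.toMatrix * Vᴴ) *ᵥ ψ := by
  have hφ := hU.conjTranspose.2 ψ hψ
  have h1 : Vᴴ *ᵥ ψ = Uᴴ *ᵥ ψ := by
    conv_lhs => rw [← one_mulVec ψ, ← hU.mul_conjTranspose, ← mulVec_mulVec, h _ hφ,
      mulVec_mulVec, hV.conjTranspose_mul, one_mulVec]
  rw [← mulVec_mulVec, ← mulVec_mulVec, ← mulVec_mulVec, ← mulVec_mulVec, h1, ← hPP' _ hφ]
  exact h _ ((isLogicalGate_toMatrix hP).2 _ hφ)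

/-- Membership in the hierarchy only depends on the action on the code space. -/
theorem logicalClifford_congr {U V : Matrix (Q → Fin 2) (Q → Fin 2) ℂ} {m : ℕ}
    (hU : U ∈ S.logicalClifford (m + 1)) (hV : S.IsLogicalGate V)
    (h : ∀ ψ ∈ S.codeSpace, U *ᵥ ψ = V *ᵥ ψ) : V ∈ S.logicalClifford (m + 1) := by
  induction m generalizing U V with
  | zero =>
    obtain ⟨-, P, hP, c, hc⟩ := mem_logicalClifford_one.mp hU
    exact mem_logicalClifford_one.mpr ⟨hV, P, hP, c, fun ψ hψ => by rw [← h ψ hψ, hc ψ hψ]⟩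
  | succ m ih =>
    obtain ⟨hUg, hUP⟩ := mem_logicalClifford_add_two.mp hU
    exact mem_logicalClifford_add_two.mpr ⟨hV, fun P hP => ih (hUP P hP) (hV.conj_toMatrix hP)
      fun ψ hψ => hUg.conj_mulVec_congr hV h hP (fun _ _ => rfl) hψ⟩

theorem logicalClifford_one_subset (m : ℕ) :
    S.logicalClifford 1 ⊆ S.logicalClifford (m + 1) := by
  induction m with
  | zero => exact subset_rfl
  | succ m ih =>
    intro U hU
    obtain ⟨hUg, P, hP, c, hc⟩ := mem_logicalClifford_one.mp hU
    refine mem_logicalClifford_add_two.mpr ⟨hUg, fun R hR => ih ?_⟩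
    refine mem_logicalClifford_one.mpr ⟨hUg.conj_toMatrix hR, R, hR, commSign P R, fun ψ hψ => ?_⟩
    have hφ := hUg.conjTranspose.2 ψ hψ
    -- On the code space `U R U† = c P R U†`, which is `c R P U† = R U U†` up to the sign.
    have h1 : c • P.toMatrix *ᵥ (Uᴴ *ᵥ ψ) = ψ := by
      rw [← hc _ hφ, mulVec_mulVec, hUg.mul_conjTranspose, one_mulVec]
    rw [← mulVec_mulVec, ← mulVec_mulVec, hc _ ((isLogicalGate_toMatrix hR).2 _ hφ),
      mulVec_mulVec, toMatrix_mul_toMatrix, smul_mulVec, ← mulVec_mulVec, smul_comm,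
      ← mulVec_smul, h1]

theorem mul_toMatrix_mem_logicalClifford {U : Matrix (Q → Fin 2) (Q → Fin 2) ℂ} {m : ℕ}
    (hU : U ∈ S.logicalClifford (m + 1)) {P : PauliOp Q} (hP : P ∈ S.logicalPaulis) :
    U * P.toMatrix ∈ S.logicalClifford (m + 1) := by
  cases m with
  | zero =>
    obtain ⟨hUg, R, hR, c, hc⟩ := mem_logicalClifford_one.mp hU
    refine mem_logicalClifford_one.mpr ⟨hUg.mul (isLogicalGate_toMatrix hP), R * P,
      mul_mem hR hP, c, fun ψ hψ => ?_⟩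
    rw [← mulVec_mulVec, hc _ ((isLogicalGate_toMatrix hP).2 _ hψ), mulVec_mulVec, ← map_mul]
  | succ m =>
    obtain ⟨hUg, hUP⟩ := mem_logicalClifford_add_two.mp hU
    refine mem_logicalClifford_add_two.mpr ⟨hUg.mul (isLogicalGate_toMatrix hP), fun R hR => ?_⟩
    have h1 := hUP (P * R * P⁻¹) (mul_mem (mul_mem hP hR) (inv_mem hP))
    rw [map_mul, map_mul] at h1
    rw [Matrix.conjTranspose_mul, conjTranspose_toMatrix]
    simpa only [Matrix.mul_assoc] using h1

theorem mem_logicalClifford_one_of_mulVec_eq_smul {U : Matrix (Q → Fin 2) (Q → Fin 2) ℂ}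
    (hU : S.IsLogicalGate U) {c : ℂ} (hc : ∀ ψ ∈ S.codeSpace, U *ᵥ ψ = c • ψ) :
    U ∈ S.logicalClifford 1 :=
  mem_logicalClifford_one.mpr ⟨hU, 1, one_mem _, c, fun ψ hψ => by
    rw [map_one, one_mulVec, hc ψ hψ]⟩

/-- If, on the code space, the operator `V` commutes with the logical operators in `G` up to given
factors, then the terms of a Pauli expansion of `V` that commute with them up to other factors can
be eliminated. -/
theorem exists_expansion_commSign_eq {V : Matrix (Q → Fin 2) (Q → Fin 2) ℂ} {G : Set (PauliOp Q)}
    (hG : G ⊆ S.logicalPaulis) {lam : PauliOp Q → ℂ}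
    (hV : ∀ R ∈ G, ∀ ψ ∈ S.codeSpace, V *ᵥ (R.toMatrix *ᵥ ψ) = lam R • R.toMatrix *ᵥ (V *ᵥ ψ))
    (T : Finset (PauliOp Q)) (c : PauliOp Q → ℂ)
    (hc : ∀ ψ ∈ S.codeSpace, V *ᵥ ψ = ∑ P ∈ T, c P • P.toMatrix *ᵥ ψ) :
    ∃ T' ⊆ T, ∃ c' : PauliOp Q → ℂ,
      (∀ ψ ∈ S.codeSpace, V *ᵥ ψ = ∑ P ∈ T', c' P • P.toMatrix *ᵥ ψ) ∧
      ∀ P ∈ T', ∀ R ∈ G, commSign P R = lam R := by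
  classical
  induction T using Finset.strongInduction generalizing c with
  | H T ih =>
    by_cases hT : ∀ P ∈ T, ∀ R ∈ G, commSign P R = lam R
    · exact ⟨T, subset_rfl, c, hc, hT⟩
    push Not at hT
    obtain ⟨P₁, hP₁, R, hR, hne⟩ := hT
    have hne' : lam R - commSign P₁ R ≠ 0 := sub_ne_zero.mpr hne.symm
    obtain ⟨T', hT', h⟩ := ih (T.erase P₁) (Finset.erase_ssubset hP₁)
      (fun P => (lam R - commSign P₁ R)⁻¹ * (c P * (commSign P R - commSign P₁ R)))
      fun ψ hψ => by
        -- `R⁻¹ V R` is `lam R • V`, and each term `P` of its expansion gets the factor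
        -- `commSign P R`; subtracting `commSign P₁ R • V` cancels the term `P₁`.
        have h1 : lam R • V *ᵥ ψ = ∑ P ∈ T, (c P * commSign P R) • P.toMatrix *ᵥ ψ := by
          have h2 : R.toMatrix *ᵥ (lam R • V *ᵥ ψ)
              = R.toMatrix *ᵥ ∑ P ∈ T, (c P * commSign P R) • P.toMatrix *ᵥ ψ := by
            rw [mulVec_smul, ← hV R hR ψ hψ, hc _ ((isLogicalGate_toMatrix (hG hR)).2 _ hψ),
              mulVec_sum]
            refine Finset.sum_congr rfl fun P _ => ?_
            rw [mulVec_smul, mulVec_mulVec, mulVec_mulVec, toMatrix_mul_toMatrix, smul_mulVec,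
              smul_smul]
          have h3 := congrArg (fun φ => (R⁻¹).toMatrix *ᵥ φ) h2
          simpa only [mulVec_mulVec, toMatrix_inv_mul, one_mulVec] using h3
        have h4 : (lam R - commSign P₁ R) • V *ᵥ ψ
            = ∑ P ∈ T, (c P * (commSign P R - commSign P₁ R)) • P.toMatrix *ᵥ ψ := by
          rw [sub_smul, h1, hc ψ hψ, Finset.smul_sum, ← Finset.sum_sub_distrib]
          refine Finset.sum_congr rfl fun P _ => ?_
          rw [smul_smul, ← sub_smul]
          congr 1
          ring
        rw [← Finset.add_sum_erase _ _ hP₁, sub_self, mul_zero, zero_smul, zero_add] at h4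
        rw [← inv_smul_smul₀ hne' (V *ᵥ ψ), h4, Finset.smul_sum]
        exact Finset.sum_congr rfl fun P _ => by rw [smul_smul]
    exact ⟨T', hT'.trans (Finset.erase_subset _ _), h⟩

/-- A logical gate on fewer qubits than the min-distance acts as a scalar on the code space. -/
theorem exists_mulVec_eq_smul_of_card_lt {v : Q → Matrix (Fin 2) (Fin 2) ℂ} {R : Finset Q}
    (hv : ∀ q, q ∉ R → v q = 1) (hV : S.IsLogicalGate (tensorOp v))
    (hR : R.card < S.minDistance) :
    ∃ c : ℂ, ∀ ψ ∈ S.codeSpace, tensorOp v *ᵥ ψ = c • ψ := by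
  obtain ⟨T, c, hT, hc⟩ := exists_tensorOp_eq_sum_toMatrix hv
  obtain ⟨T', hT', c', hc', hcomm⟩ := exists_expansion_commSign_eq (S := S) (V := tensorOp v)
    (G := S.group) S.group_le_logicalPaulis (lam := fun _ => 1)
    (fun s hs ψ hψ => by rw [hψ s hs, one_smul, hV.2 ψ hψ s hs]) T c
    (fun ψ _ => by rw [hc, sum_mulVec]; simp only [smul_mulVec])
  have hμ : ∀ P ∈ T', ∃ μ : ℂ, ∀ ψ ∈ S.codeSpace, P.toMatrix *ᵥ ψ = μ • ψ := by
    intro P hP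
    have hPl : P ∈ S.logicalPaulis := S.mem_logicalPaulis_iff.mpr fun s hs =>
      commSign_eq_one_iff.mp (hcomm P hP s hs)
    refine exists_mulVec_eq_smul_of_scalar_mul_mem (S.exists_scalar_mul_mem hPl fun hn => ?_)
    have h1 := S.minDistance_le_card_supp hn
    have h2 := Finset.card_le_card (hT P (hT' hP))
    omega
  choose! μ hμ using hμ
  refine ⟨∑ P ∈ T', c' P * μ P, fun ψ hψ => ?_⟩
  rw [hc' ψ hψ, Finset.sum_smul]
  exact Finset.sum_congr rfl fun P hP => by rw [hμ P hP ψ hψ, smul_smul]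

/-- A transversal gate that commutes with all the logical operators up to scalars on the code space
acts as a logical operator: the remaining terms of its Pauli expansion differ from each other by
operators that commute with all the logical operators, that is, by stabilizers and phases. -/
theorem mem_logicalClifford_one_of_commute {v : Q → Matrix (Fin 2) (Fin 2) ℂ}
    (hV : S.IsLogicalGate (tensorOp v))
    (h : ∀ L ∈ S.logicalPaulis, ∃ μ : ℂ, ∀ ψ ∈ S.codeSpace,
      tensorOp v *ᵥ (L.toMatrix *ᵥ ψ) = μ • L.toMatrix *ᵥ (tensorOp v *ᵥ ψ)) :
    tensorOp v ∈ S.logicalClifford 1 := by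
  classical
  choose! μ hμ using h
  obtain ⟨T, c, -, hc⟩ := exists_tensorOp_eq_sum_toMatrix (v := v) (R := Finset.univ)
    fun q hq => absurd (Finset.mem_univ q) hq
  -- For the stabilizers the factor has to be `1`; the factor `μ` is arbitrary if the code space
  -- is trivial.
  obtain ⟨T', -, c', hc', hcomm⟩ := exists_expansion_commSign_eq (S := S) (V := tensorOp v)
    (G := S.logicalPaulis) subset_rfl (lam := fun L => if L ∈ S.group then 1 else μ L)
    (fun L hL ψ hψ => by
      by_cases hs : L ∈ S.group
      · rw [if_pos hs, hψ L hs, one_smul, hV.2 ψ hψ L hs]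
      · rw [if_neg hs, hμ L hL ψ hψ]) T c
    (fun ψ _ => by rw [hc, sum_mulVec]; simp only [smul_mulVec])
  have hPl : ∀ P ∈ T', P ∈ S.logicalPaulis := fun P hP =>
    S.mem_logicalPaulis_iff.mpr fun s hs => commSign_eq_one_iff.mp (by
      rw [hcomm P hP s (S.group_le_logicalPaulis hs), if_pos hs])
  rcases T'.eq_empty_or_nonempty with rfl | ⟨P₀, hP₀⟩
  · exact mem_logicalClifford_one_of_mulVec_eq_smul hV (c := 0) fun ψ hψ => by
      rw [hc' ψ hψ, Finset.sum_empty, zero_smul]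
  have hν : ∀ P ∈ T', ∃ ν : ℂ, ∀ ψ ∈ S.codeSpace, P.toMatrix *ᵥ ψ = ν • P₀.toMatrix *ᵥ ψ := by
    intro P hP
    obtain ⟨ν, hν⟩ := exists_mulVec_eq_smul_of_scalar_mul_mem
      (S.exists_scalar_mul_mem_of_commute (P := P * P₀⁻¹) fun L hL => by
        have h1 : commSign P L = commSign P₀ L := by rw [hcomm P hP L hL, hcomm P₀ hP₀ L hL]
        have h2 : P * L = L * P ↔ P₀ * L = L * P₀ := by
          rw [← commSign_eq_one_iff, ← commSign_eq_one_iff, h1]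
        rw [mul_comm_iff_symplecticForm, mul_comm_iff_symplecticForm] at h2
        have hinv : (P₀⁻¹).vec = P₀.vec := rfl
        rw [mul_comm_iff_symplecticForm, vec_mul, hinv, map_add, LinearMap.add_apply]
        have key : ∀ a b : ZMod 2, (a = 0 ↔ b = 0) → a + b = 0 := by decide
        exact key _ _ h2)
    refine ⟨ν, fun ψ hψ => ?_⟩
    rw [← hν _ ((isLogicalGate_toMatrix (hPl P₀ hP₀)).2 ψ hψ), mulVec_mulVec, ← map_mul,
      inv_mul_cancel_right]
  choose! ν hν using hν
  refine mem_logicalClifford_one.mpr ⟨hV, P₀, hPl P₀ hP₀, ∑ P ∈ T', c' P * ν P, fun ψ hψ => ?_⟩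
  rw [hc' ψ hψ, Finset.sum_smul]
  exact Finset.sum_congr rfl fun P hP => by rw [hν P hP ψ hψ, smul_smul]

/-! ### Shrinking the support of transversal gates by commutators -/

/-- The group commutator of a transversal gate on the region `R` with a Pauli operator `P` is a
transversal gate on the intersection of `R` with the support of `P`. -/
theorem exists_tensorOp_mul_toMatrix_eq_conj {v : Q → Matrix (Fin 2) (Fin 2) ℂ} {R : Finset Q}
    (hu : ∀ q, v q ∈ unitaryGroup (Fin 2) ℂ) (hv : ∀ q, q ∉ R → v q = 1) (P : PauliOp Q) :
    ∃ k : Q → Matrix (Fin 2) (Fin 2) ℂ, (∀ q, k q ∈ unitaryGroup (Fin 2) ℂ) ∧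
      (∀ q, q ∉ P.supp ∩ R → k q = 1) ∧
      tensorOp k * P.toMatrix = tensorOp v * P.toMatrix * (tensorOp v)ᴴ := by
  have hp : ∀ q, pauliMatrix (P.x q) (P.z q) * (pauliMatrix (P.x q) (P.z q))ᴴ = 1 := fun q =>
    mem_unitaryGroup_iff.mp (pauliMatrix_mem_unitaryGroup _ _)
  have hp' : ∀ q, (pauliMatrix (P.x q) (P.z q))ᴴ * pauliMatrix (P.x q) (P.z q) = 1 := fun q =>
    mem_unitaryGroup_iff'.mp (pauliMatrix_mem_unitaryGroup _ _)
  refine ⟨fun q => v q * pauliMatrix (P.x q) (P.z q) * (v q)ᴴ * (pauliMatrix (P.x q) (P.z q))ᴴ,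
    fun q => ?_, fun q hq => ?_, ?_⟩
  · exact mul_mem (mul_mem (mul_mem (hu q) (pauliMatrix_mem_unitaryGroup _ _))
      (Unitary.star_mem (hu q))) (Unitary.star_mem (pauliMatrix_mem_unitaryGroup _ _))
  · rw [Finset.mem_inter, not_and_or] at hq
    rcases hq with hq | hq
    · rw [mem_supp, not_or, not_not, not_not] at hq
      simp only [hq.1, hq.2]
      rw [pauliMatrix_zero_zero, conjTranspose_one, mul_one, mul_one]
      exact mem_unitaryGroup_iff.mp (hu q)
    · simp only [hv q hq]
      rw [conjTranspose_one, one_mul, mul_one, hp]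
  · rw [toMatrix_apply, tensorOp_conjTranspose, Matrix.mul_smul, Matrix.mul_smul, smul_mul_assoc, tensorOp_mul,
      tensorOp_mul, tensorOp_mul]
    congr 2
    funext q
    rw [mul_assoc _ (pauliMatrix (P.x q) (P.z q))ᴴ, hp', mul_one]

theorem isLogicalGate_of_mul_toMatrix_eq_conj {K V : Matrix (Q → Fin 2) (Q → Fin 2) ℂ}
    (hV : S.IsLogicalGate V) {P : PauliOp Q} (hP : P ∈ S.logicalPaulis)
    (h : K * P.toMatrix = V * P.toMatrix * Vᴴ) : S.IsLogicalGate K := by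
  have h1 : K = V * P.toMatrix * Vᴴ * (P⁻¹).toMatrix := by
    rw [← h, mul_assoc, toMatrix_mul_inv, mul_one]
  rw [h1]
  exact (hV.conj_toMatrix hP).mul (isLogicalGate_toMatrix (inv_mem hP))

/-- A transversal gate is in level `m + 1` if its commutators with some representatives of the
logical operators are in level `m`. -/
theorem mem_logicalClifford_add_two_of_commutators {v : Q → Matrix (Fin 2) (Fin 2) ℂ}
    {R : Finset Q} (hu : ∀ q, v q ∈ unitaryGroup (Fin 2) ℂ) (hv : ∀ q, q ∉ R → v q = 1)
    (hV : S.IsLogicalGate (tensorOp v)) {m : ℕ}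
    (h : ∀ L ∈ S.nontrivialLogicals, ∃ P ∈ S.representatives L,
      ∀ k : Q → Matrix (Fin 2) (Fin 2) ℂ, (∀ q, k q ∈ unitaryGroup (Fin 2) ℂ) →
        (∀ q, q ∉ P.supp ∩ R → k q = 1) → S.IsLogicalGate (tensorOp k) →
        tensorOp k ∈ S.logicalClifford (m + 1)) :
    tensorOp v ∈ S.logicalClifford (m + 2) := by
  refine mem_logicalClifford_add_two.mpr ⟨hV, fun L hL => ?_⟩
  by_cases hLn : L ∈ S.nontrivialLogicals
  · obtain ⟨P, hP, hk⟩ := h L hLn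
    have hPl := S.mem_logicalPaulis_of_mem_representatives hL hP
    obtain ⟨k, hku, hk1, hkP⟩ := exists_tensorOp_mul_toMatrix_eq_conj hu hv P
    have h1 := mul_toMatrix_mem_logicalClifford
      (hk k hku hk1 (isLogicalGate_of_mul_toMatrix_eq_conj hV hPl hkP)) hPl
    rw [hkP] at h1
    exact logicalClifford_congr h1 (hV.conj_toMatrix hL) fun ψ hψ =>
      hV.conj_mulVec_congr hV (fun _ _ => rfl) hPl
        (fun _ hφ => mulVec_eq_of_mem_representatives hP hφ) hψ
  · obtain ⟨μ, hμ⟩ := exists_mulVec_eq_smul_of_scalar_mul_mem (S.exists_scalar_mul_mem hL hLn)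
    refine logicalClifford_one_subset m
      (mem_logicalClifford_one_of_mulVec_eq_smul (hV.conj_toMatrix hL) (c := μ) fun ψ hψ => ?_)
    rw [← mulVec_mulVec, ← mulVec_mulVec, hμ _ (hV.conjTranspose.2 ψ hψ), mulVec_smul,
      mulVec_mulVec, hV.mul_conjTranspose, one_mulVec]

/-- The commutators with scrubbed representatives shrink the region of a transversal gate by the
factor `Δ`, until it is too small to support a logical operator. -/
theorem mem_logicalClifford_of_card_lt (hΔ : 0 < S.disjointness) {m : ℕ}
    {v : Q → Matrix (Fin 2) (Fin 2) ℂ} {R : Finset Q}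
    (hu : ∀ q, v q ∈ unitaryGroup (Fin 2) ℂ) (hv : ∀ q, q ∉ R → v q = 1)
    (hV : S.IsLogicalGate (tensorOp v))
    (hR : (R.card : ℝ) < S.minDistance * S.disjointness ^ (m + 1)) :
    tensorOp v ∈ S.logicalClifford (m + 1) := by
  induction m generalizing v R with
  | zero =>
    rw [zero_add, pow_one] at hR
    refine mem_logicalClifford_one_of_commute hV fun L hL => ?_
    by_cases hLn : L ∈ S.nontrivialLogicals
    · obtain ⟨P, hP, hPR⟩ := S.exists_mem_representatives_card_supp_inter_le hLn R
      have hPl := S.mem_logicalPaulis_of_mem_representatives hL hP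
      have hcard : (P.supp ∩ R).card < S.minDistance := by
        exact_mod_cast lt_of_mul_lt_mul_right (hPR.trans_lt hR) hΔ.le
      obtain ⟨k, -, hk1, hkP⟩ := exists_tensorOp_mul_toMatrix_eq_conj hu hv P
      obtain ⟨μ, hμ⟩ := exists_mulVec_eq_smul_of_card_lt hk1
        (isLogicalGate_of_mul_toMatrix_eq_conj hV hPl hkP) hcard
      refine ⟨μ, fun ψ hψ => ?_⟩
      have hVψ := hV.2 ψ hψ
      rw [← mulVec_eq_of_mem_representatives hP hψ, ← mulVec_eq_of_mem_representatives hP hVψ,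
        ← hμ _ ((isLogicalGate_toMatrix hPl).2 _ hVψ), mulVec_mulVec _ (tensorOp k), hkP,
        mulVec_mulVec, mulVec_mulVec, mul_assoc _ (tensorOp v)ᴴ, hV.conjTranspose_mul, mul_one]
    · obtain ⟨μ, hμ⟩ := exists_mulVec_eq_smul_of_scalar_mul_mem (S.exists_scalar_mul_mem hL hLn)
      refine ⟨1, fun ψ hψ => ?_⟩
      rw [hμ ψ hψ, hμ _ (hV.2 ψ hψ), mulVec_smul, one_smul]
  | succ m ih =>
    refine mem_logicalClifford_add_two_of_commutators hu hv hV fun L hL => ?_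
    obtain ⟨P, hP, hPR⟩ := S.exists_mem_representatives_card_supp_inter_le hL R
    refine ⟨P, hP, fun k hku hk1 hkg => ih hku hk1 hkg ?_⟩
    refine lt_of_mul_lt_mul_right (hPR.trans_lt ?_) hΔ.le
    rwa [mul_assoc, ← pow_succ]

theorem IsTransversalGate.mem_logicalClifford (hΔ : 0 < S.disjointness) {m : ℕ}
    (hm : (S.maxDistance : ℝ) < S.minDistance * S.disjointness ^ (m + 1))
    {U : Matrix (Q → Fin 2) (Q → Fin 2) ℂ} (hU : S.IsTransversalGate U) :
    U ∈ S.logicalClifford (m + 2) := by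
  obtain ⟨hUg, u, hu, rfl⟩ := hU
  refine mem_logicalClifford_add_two_of_commutators (R := Finset.univ) hu
    (fun q hq => absurd (Finset.mem_univ q) hq) hUg fun L hL => ?_
  obtain ⟨P, hP, hcard⟩ := S.exists_mem_representatives_card_supp_le hL
  refine ⟨P, hP, fun k hku hk1 hkg => mem_logicalClifford_of_card_lt hΔ hku hk1 hkg ?_⟩
  rw [Finset.inter_univ]
  exact lt_of_le_of_lt (by exact_mod_cast hcard) hm

end LogicalGates

end StabilizerCode

/-! ### The attainable level of the concatenated code -/

namespace StabilizerCode

variable {Q : Type*} [Fintype Q]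

theorem floor_logb_nonneg (S : StabilizerCode Q) (hd : 1 < S.minDistance) :
    0 ≤ ⌊Real.logb S.disjointness ((S.maxDistance : ℝ) / S.minDistance)⌋ := by
  have hd0 : (0 : ℝ) < S.minDistance := by exact_mod_cast zero_lt_one.trans hd
  refine Int.floor_nonneg.mpr (Real.logb_nonneg (S.one_lt_disjointness hd) ?_)
  rw [one_le_div hd0]
  exact_mod_cast S.minDistance_le_maxDistance
    (S.nontrivialLogicals_nonempty (zero_lt_one.trans hd))

theorem maxDistance_lt_of_floor_logb_le (S : StabilizerCode Q) (hd : 1 < S.minDistance) {m : ℕ}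
    (hm : ⌊Real.logb S.disjointness ((S.maxDistance : ℝ) / S.minDistance)⌋ ≤ m) :
    (S.maxDistance : ℝ) < S.minDistance * S.disjointness ^ (m + 1) := by
  have hd0 : (0 : ℝ) < S.minDistance := by exact_mod_cast zero_lt_one.trans hd
  have hmax : (0 : ℝ) < S.maxDistance := hd0.trans_le (by
    exact_mod_cast S.minDistance_le_maxDistance
      (S.nontrivialLogicals_nonempty (zero_lt_one.trans hd)))
  have h1 : Real.logb S.disjointness ((S.maxDistance : ℝ) / S.minDistance) < ((m + 1 : ℕ) : ℝ) := by
    have h2 := Int.lt_floor_add_one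
      (Real.logb S.disjointness ((S.maxDistance : ℝ) / S.minDistance))
    refine h2.trans_le ?_
    push_cast
    exact add_le_add_left (by exact_mod_cast hm) 1
  rw [Real.logb_lt_iff_lt_rpow (S.one_lt_disjointness hd) (div_pos hmax hd0), Real.rpow_natCast,
    div_lt_iff₀' hd0] at h1
  exact h1

theorem exists_isTransversalLevel_le [DecidableEq Q] {S : StabilizerCode Q} {m : ℕ} (hm : 1 ≤ m)
    (h : ∀ U, S.IsTransversalGate U → U ∈ S.logicalClifford m) :
    ∃ M ≤ m, S.IsTransversalLevel M := by
  have hmem : m ∈ {m | 1 ≤ m ∧ ∀ U, S.IsTransversalGate U → U ∈ S.logicalClifford m} := ⟨hm, h⟩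
  exact ⟨_, Nat.sInf_le hmem, Nat.sInf_mem ⟨m, hmem⟩, fun _ hn => Nat.sInf_le hn⟩

end StabilizerCode

theorem proposition3 {Q₁ Q₂ : Type*} [Fintype Q₁] [DecidableEq Q₁] [Fintype Q₂] [DecidableEq Q₂]
    (S₁ : StabilizerCode Q₁) (S₂ : StabilizerCode Q₂) (hk₂ : S₂.Encodes 1) (B : LogicalQubit S₂)
    (hd₁ : 1 < S₁.minDistance) (hd₂ : 1 < S₂.minDistance) :
    S₁.disjointness * S₂.disjointness ≤ (S₁.concat S₂ B).disjointness ∧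
    1 < S₁.disjointness ∧ 1 < S₂.disjointness ∧
    ∃ M : ℕ, (S₁.concat S₂ B).IsTransversalLevel M ∧
      (M : ℤ) ≤ max
        ⌊Real.logb S₁.disjointness ((S₁.maxDistance : ℝ) / S₁.minDistance)⌋
        ⌊Real.logb S₂.disjointness ((S₂.maxDistance : ℝ) / S₂.minDistance)⌋ + 2 := by
  have hne := S₁.nontrivialLogicals_nonempty (zero_lt_one.trans hd₁)
  have hmul := StabilizerCode.disjointness_mul_le_concat (B := B) hk₂ hne
  have h₁ := S₁.one_lt_disjointness hd₁
  have h₂ := S₂.one_lt_disjointness hd₂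
  refine ⟨hmul, h₁, h₂, ?_⟩
  obtain ⟨m, hm⟩ := Int.eq_ofNat_of_zero_le (le_max_of_le_left (S₁.floor_logb_nonneg hd₁) :
    0 ≤ max ⌊Real.logb S₁.disjointness ((S₁.maxDistance : ℝ) / S₁.minDistance)⌋
      ⌊Real.logb S₂.disjointness ((S₂.maxDistance : ℝ) / S₂.minDistance)⌋)
  have hpos : 0 < S₁.disjointness * S₂.disjointness := by positivity
  have hlt : ((S₁.concat S₂ B).maxDistance : ℝ)
      < (S₁.concat S₂ B).minDistance * (S₁.concat S₂ B).disjointness ^ (m + 1) := by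
    calc ((S₁.concat S₂ B).maxDistance : ℝ) ≤ S₁.maxDistance * S₂.maxDistance := by
          exact_mod_cast StabilizerCode.concat_maxDistance_le (B := B) hk₂
      _ < (S₁.minDistance * S₁.disjointness ^ (m + 1))
            * (S₂.minDistance * S₂.disjointness ^ (m + 1)) :=
          mul_lt_mul'' (S₁.maxDistance_lt_of_floor_logb_le hd₁ (hm ▸ le_max_left _ _))
            (S₂.maxDistance_lt_of_floor_logb_le hd₂ (hm ▸ le_max_right _ _))
            (Nat.cast_nonneg _) (Nat.cast_nonneg _)
      _ = ((S₁.minDistance * S₂.minDistance : ℕ) : ℝ)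
            * (S₁.disjointness * S₂.disjointness) ^ (m + 1) := by push_cast; ring
      _ ≤ _ := mul_le_mul
          (Nat.cast_le.mpr (StabilizerCode.minDistance_mul_le_concat (B := B) hk₂ hne))
          (pow_le_pow_left₀ hpos.le hmul _) (by positivity) (Nat.cast_nonneg _)
  obtain ⟨M, hM, hMl⟩ := StabilizerCode.exists_isTransversalLevel_le (m := m + 2) (by omega)
    fun U hU => hU.mem_logicalClifford (hpos.trans_le hmul) hlt
  refine ⟨M, hMl, ?_⟩
  rw [hm]
  exact_mod_cast hM
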